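/- Let $k\ge 3$ be an integer and let $f$ be an orientation preserving $C^k$ diffeomorphism of the circle $\mathbb T=\mathbb R/\mathbb Z$ (that is, $f$ is the projection to $\mathbb T$ of an increasing bijection $F$ of $\mathbb R$ which commutes with $x\mapsto x+1$ and which, together with its inverse, is of class $C^k$). Assume that its rotation number, the class mod $1$ of $\lim_{m\to\infty}(F^m(x)-x)/m$, is the class of an irrational number $\alpha\in(0,1)$. Let $p_n/q_n$ $(n\ge 0)$ be the convergents of the continued fraction of $\alpha$ (with $p_0/q_0=0/1$) and let $\alpha_n=|q_n\alpha-p_n|$. For $x\in\mathbb T$ let $I_n(x)$ be the arc from $x$ to $f^{q_n}(x)$ in the positive direction if $n$ is even, and the arc from $f^{q_n}(x)$ to $x$ in the positive direction if $n$ is odd; let $\beta_n(x)=|I_n(x)|$ be its length and let $M_n=\max_{x\in\mathbb T}\beta_n(x)$. Then there is a constant $C>0$, depending only on $f$ and $k$, such that for all $n\ge 0$ and all $x\in\mathbb T$ $$\left|\beta_{n+1}(x)-\frac{\alpha_{n+1}}{\alpha_n}\,\beta_n(x)\right|\le C\left[M_n^{(k-1)/2}\,\beta_n(x)+M_n^{1/2}\,\beta_{n+1}(x)\right].$$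 -/

import Mathlib

namespace CircleDynamics

/-- `F : ℝ → ℝ` (nondecreasing, commuting with `x ↦ x + 1`) is a lift of the map `f` of the
circle `𝕋 = ℝ / ℤ`. -/
def IsLift (F : CircleDeg1Lift) (f : UnitAddCircle → UnitAddCircle) : Prop :=
  ∀ x : ℝ, f (x : UnitAddCircle) = ((F x : ℝ) : UnitAddCircle)

/-- `f` is an orientation preserving diffeomorphism of class `C^k` of the circle: it is the
projection of an increasing bijection `F` of the real line which commutes with `x ↦ x + 1` and
which, together with its inverse, is of class `C^k`. -/
def IsCircleDiffeo (k : ℕ) (f : UnitAddCircle → UnitAddCircle) : Prop :=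
  ∃ F : CircleDeg1Liftˣ,
    ContDiff ℝ k (fun x : ℝ => (F : CircleDeg1Lift) x) ∧
    ContDiff ℝ k (fun x : ℝ => ((F⁻¹ : CircleDeg1Liftˣ) : CircleDeg1Lift) x) ∧
    IsLift (F : CircleDeg1Lift) f

/-- The rotation number of `f` is `ρ ∈ ℝ / ℤ`: it is the class modulo `1` of
`lim (F^n x - x) / n`, where `F` is a lift of `f`. -/
def HasRotationNumber (f : UnitAddCircle → UnitAddCircle) (ρ : UnitAddCircle) : Prop :=
  ∃ F : CircleDeg1Lift, IsLift F f ∧ ((F.translationNumber : ℝ) : UnitAddCircle) = ρ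

/-- The numerator `p_n` of the `n`-th convergent of `α` (`p_0 / q_0 = ⌊α⌋ / 1`). -/
noncomputable def convNum (α : ℝ) (n : ℕ) : ℤ := (α.convergent n).num

/-- The denominator `q_n` of the `n`-th convergent of `α`. -/
noncomputable def convDen (α : ℝ) (n : ℕ) : ℕ := (α.convergent n).den

/-- `α_n = |q_n α - p_n|`. -/
noncomputable def convDist (α : ℝ) (n : ℕ) : ℝ :=
  |(convDen α n : ℝ) * α - (convNum α n : ℝ)|

/-- The length, in `[0, 1)`, of the arc of the circle that goes from `x` to `y` in the positive
direction. -/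
noncomputable def arcLength (x y : UnitAddCircle) : ℝ :=
  (AddCircle.equivIco (1 : ℝ) 0 (y - x) : ℝ)

/-- `β_n(x)`, the length of the arc `I_n(x)` between `x` and `f^{q_n}(x)`: the arc
`(x, f^{q_n}(x))` if `n` is even, and `(f^{q_n}(x), x)` if `n` is odd. -/
noncomputable def beta (f : UnitAddCircle → UnitAddCircle) (α : ℝ) (n : ℕ)
    (x : UnitAddCircle) : ℝ :=
  if Even n then arcLength x (f^[convDen α n] x) else arcLength (f^[convDen α n] x) x

/-- `M_n`, the maximum of `β_n` over the circle. -/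
noncomputable def betaMax (f : UnitAddCircle → UnitAddCircle) (α : ℝ) (n : ℕ) : ℝ :=
  ⨆ x : UnitAddCircle, beta f α n x

end CircleDynamics

/-!
Write `g = F^{q_n} - p_n` and `e = F^{q_{n+1}} - p_{n+1}` for the return maps of a lift `F`, and
`M = M_n`. After a conjugation by `x ↦ -x` one may assume that `n` is even, so that
`β_n(x) = g x - x` and `β_{n+1}(x) = x - e x`. All the constants below depend on `F` and `k` only.

*Distortion.* The arcs `F^i [x, g x]`, `i < q_{n+1}`, are disjoint modulo `1`, so that the iterates
`F^l`, `l ≤ q_{n+1}`, have bounded distortion on `[x, g x]`, and the cocycle relation for the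
Schwarzian derivative gives `|S F^l| ≤ C M / β_n²`. Hence these iterates are `O(M)`-close to Möbius
maps on `[x, g x]`.

*The multiplier of `g`.* The trace `T(x)` of the Möbius map with the same 2-jet as `g` at `x`
(`moebTrace`) satisfies `T' = - β_n S g / (2 √Dg)`, and it is invariant up to `O(M)` under the `F^l`,
which commute with `g`. As each orbit segment of length `q_n + q_{n+1}` meets each arc `[x, g x]`,
`T` is constant up to `O(M)` on the circle. Where `β_n` is minimal, `T ≤ 2`; where `|log Dg|` is
maximal, `T = 2 cosh (log Dg / 2)`. Therefore `log Dg = O(√M)` everywhere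
(`IsSmoothLift.exists_abs_log_deriv_le`), and then `D log DF^l = O(√M / β_n)`. An induction which
uses `D N = S + N² / 2` for the nonlinearity `N = D log DF^l` gives
`D^j N = O((√M / β_n)^{j+1})` for `j ≤ k - 2`.

*Comparison of displacements.* By the previous step `β_{n+1} / β_n` is invariant up to a factor
`1 + O(√M)` along orbit segments of length `q_{n+1}`, and `β_n(g x) / β_n(x) = 1 + O(√M)`. So
`β_{n+1}` is almost constant on `x, g x, …, g^{k-1} x`; since its derivative of order `k` is
`O((√M / β_n)^{k-1})`, interpolation at these points shows that `β_{n+1}` varies on `[x, g x]` by at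
most `C (M^{(k-1)/2} β_n(x) + M^{1/2} β_{n+1}(x))`
(`IsSmoothLift.exists_abs_displacement_sub_le`). Comparing Birkhoff sums, there is a point `z` with
`β_{n+1}(z) / β_n(z) = α_{n+1} / α_n` exactly, and an iterate of `z` of order less than
`q_n + q_{n+1}` lies in `[x, g x]`; the ratio is transported from `z` to this iterate, and from there
to `x`.
-/

namespace CircleDynamics

section

open Set Filter Topology Finset

/-! ### Nonlinearity and Schwarzian derivative -/

/-- The nonlinearity `D log Dh = D²h / Dh` of a diffeomorphism `h` of the line. -/
noncomputable def nonlin (h : ℝ → ℝ) (x : ℝ) : ℝ := deriv (deriv h) x / deriv h x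

/-- The Schwarzian derivative `S h = D N - N² / 2`, where `N` is the nonlinearity of `h`. -/
noncomputable def schw (h : ℝ → ℝ) (x : ℝ) : ℝ := deriv (nonlin h) x - nonlin h x ^ 2 / 2

lemma contDiff_deriv_of_succ {m n : ℕ} {h : ℝ → ℝ} (hh : ContDiff ℝ n h) (hmn : m + 1 ≤ n) :
    ContDiff ℝ m (deriv h) := by
  have : ContDiff ℝ ((m : ℕ∞) + 1 : ℕ∞) h := hh.of_le (by exact_mod_cast hmn)
  have h2 := (contDiff_succ_iff_deriv (n := (m : WithTop ℕ∞)) (f := h)).1 (by exact_mod_cast this)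
  exact h2.2.2

lemma contDiff_nonlin {m n : ℕ} {h : ℝ → ℝ} (hh : ContDiff ℝ n h) (hpos : ∀ x, 0 < deriv h x)
    (hmn : m + 2 ≤ n) : ContDiff ℝ m (nonlin h) := by
  have h1 : ContDiff ℝ (m + 1 : ℕ) (deriv h) := contDiff_deriv_of_succ hh (by omega)
  have h2 : ContDiff ℝ m (deriv (deriv h)) := contDiff_deriv_of_succ h1 le_rfl
  exact h2.div (h1.of_le (by exact_mod_cast Nat.le_succ m)) (fun x => (hpos x).ne')

lemma contDiff_schw {m n : ℕ} {h : ℝ → ℝ} (hh : ContDiff ℝ n h) (hpos : ∀ x, 0 < deriv h x)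
    (hmn : m + 3 ≤ n) : ContDiff ℝ m (schw h) := by
  have h1 : ContDiff ℝ (m + 1 : ℕ) (nonlin h) := contDiff_nonlin hh hpos (by omega)
  have h2 : ContDiff ℝ m (deriv (nonlin h)) := contDiff_deriv_of_succ h1 le_rfl
  exact h2.sub (((h1.of_le (by exact_mod_cast Nat.le_succ m)).pow 2).div_const 2)

lemma hasDerivAt_of_contDiff {n : ℕ} {h : ℝ → ℝ} (hh : ContDiff ℝ n h) (hn : 1 ≤ n) (x : ℝ) :
    HasDerivAt h (deriv h x) x :=
  ((hh.differentiable (by exact_mod_cast (by omega : n ≠ 0))) x).hasDerivAt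

section
variable {h h₁ h₂ : ℝ → ℝ}

lemma hasDerivAt_deriv (hh : ContDiff ℝ (3 : ℕ) h) (hpos : ∀ x, 0 < deriv h x) (x : ℝ) :
    HasDerivAt (deriv h) (deriv h x * nonlin h x) x := by
  have h1 : ContDiff ℝ (2 : ℕ) (deriv h) := contDiff_deriv_of_succ hh le_rfl
  have := hasDerivAt_of_contDiff h1 (by norm_num) x
  rwa [nonlin, mul_div_cancel₀ _ (hpos x).ne']

lemma hasDerivAt_log_deriv (hh : ContDiff ℝ (3 : ℕ) h) (hpos : ∀ x, 0 < deriv h x) (x : ℝ) :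
    HasDerivAt (fun y => Real.log (deriv h y)) (nonlin h x) x := by
  have := (hasDerivAt_deriv hh hpos x).log (hpos x).ne'
  rwa [mul_div_cancel_left₀ _ (hpos x).ne'] at this

lemma hasDerivAt_nonlin (hh : ContDiff ℝ (3 : ℕ) h) (hpos : ∀ x, 0 < deriv h x) (x : ℝ) :
    HasDerivAt (nonlin h) (schw h x + nonlin h x ^ 2 / 2) x := by
  have h1 : ContDiff ℝ (1 : ℕ) (nonlin h) := contDiff_nonlin hh hpos (by omega)
  have := hasDerivAt_of_contDiff h1 le_rfl x
  rwa [schw, sub_add_cancel]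

lemma deriv_comp_eq (hh₁ : ContDiff ℝ (3 : ℕ) h₁) (hh₂ : ContDiff ℝ (3 : ℕ) h₂) (x : ℝ) :
    deriv (h₁ ∘ h₂) x = deriv h₁ (h₂ x) * deriv h₂ x :=
  ((hasDerivAt_of_contDiff hh₁ (by norm_num) (h₂ x)).comp x
    (hasDerivAt_of_contDiff hh₂ (by norm_num) x)).deriv

lemma nonlin_comp (hh₁ : ContDiff ℝ (3 : ℕ) h₁) (hh₂ : ContDiff ℝ (3 : ℕ) h₂)
    (hpos₁ : ∀ x, 0 < deriv h₁ x) (hpos₂ : ∀ x, 0 < deriv h₂ x) (x : ℝ) :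
    nonlin (h₁ ∘ h₂) x = nonlin h₁ (h₂ x) * deriv h₂ x + nonlin h₂ x := by
  have h1 : deriv (h₁ ∘ h₂) = fun y => deriv h₁ (h₂ y) * deriv h₂ y :=
    funext (deriv_comp_eq hh₁ hh₂)
  have h2 := ((hasDerivAt_deriv hh₁ hpos₁ (h₂ x)).comp x
    (hasDerivAt_of_contDiff hh₂ (by norm_num) x)).mul (hasDerivAt_deriv hh₂ hpos₂ x)
  have h3 := h2.deriv
  rw [show deriv h₁ ∘ h₂ * deriv h₂ = deriv (h₁ ∘ h₂) from h1.symm] at h3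
  rw [nonlin, h3, h1]
  have a := (hpos₁ (h₂ x)).ne'
  have b := (hpos₂ x).ne'
  simp only [Function.comp]
  field_simp

lemma schw_comp (hh₁ : ContDiff ℝ (3 : ℕ) h₁) (hh₂ : ContDiff ℝ (3 : ℕ) h₂)
    (hpos₁ : ∀ x, 0 < deriv h₁ x) (hpos₂ : ∀ x, 0 < deriv h₂ x) (x : ℝ) :
    schw (h₁ ∘ h₂) x = schw h₁ (h₂ x) * deriv h₂ x ^ 2 + schw h₂ x := by
  have h1 : nonlin (h₁ ∘ h₂) = fun y => nonlin h₁ (h₂ y) * deriv h₂ y + nonlin h₂ y :=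
    funext (nonlin_comp hh₁ hh₂ hpos₁ hpos₂)
  have h2 := (((hasDerivAt_nonlin hh₁ hpos₁ (h₂ x)).comp x
    (hasDerivAt_of_contDiff hh₂ (by norm_num) x)).mul (hasDerivAt_deriv hh₂ hpos₂ x)).add
      (hasDerivAt_nonlin hh₂ hpos₂ x)
  have h3 := h2.deriv
  rw [show nonlin h₁ ∘ h₂ * deriv h₂ + nonlin h₂ = nonlin (h₁ ∘ h₂) from h1.symm] at h3
  rw [schw, h3, h1]
  simp only [Function.comp]
  ring

/-! ### Comparison with Möbius maps -/

/-- A first order Taylor estimate on `[a, b]`, valid for base and end points in either order. -/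
lemma abs_taylor_one_le {y y₁ y₂ : ℝ → ℝ} {a b E u v : ℝ} (hy : ∀ t, HasDerivAt y (y₁ t) t)
    (hy₁ : ∀ t, HasDerivAt y₁ (y₂ t) t) (hE : ∀ t ∈ Icc a b, |y₂ t| ≤ E)
    (hu : u ∈ Icc a b) (hv : v ∈ Icc a b) :
    |y v - y u - y₁ u * (v - u)| ≤ E * (b - a) ^ 2 := by
  have hE0 : 0 ≤ E := (abs_nonneg _).trans (hE u hu)
  have hab : ∀ s ∈ Icc a b, ∀ t ∈ Icc a b, |s - t| ≤ b - a := fun s hs t ht => by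
    rw [abs_le]; constructor <;> linarith [hs.1, hs.2, ht.1, ht.2]
  have h1 : ∀ t ∈ Icc a b, ‖y₁ t - y₁ u‖ ≤ E * (b - a) := fun t ht => by
    have := (convex_Icc a b).norm_image_sub_le_of_norm_hasDerivWithin_le
      (fun s _ => (hy₁ s).hasDerivWithinAt) hE hu ht
    exact this.trans (mul_le_mul_of_nonneg_left (hab t ht u hu) hE0)
  have h2 := (convex_Icc a b).norm_image_sub_le_of_norm_hasDerivWithin_le
    (f := fun t => y t - y₁ u * t) (f' := fun t => y₁ t - y₁ u)
    (fun s _ => (((hy s).sub ((hasDerivAt_id s).const_mul (y₁ u))).congr_deriv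
      (by simp)).hasDerivWithinAt) h1 hu hv
  have h3 : y v - y u - y₁ u * (v - u) = (y v - y₁ u * v) - (y u - y₁ u * u) := by ring
  rw [h3]
  refine h2.trans ?_
  have := mul_le_mul_of_nonneg_left (hab v hv u hu)
    (mul_nonneg hE0 ((abs_nonneg _).trans (hab v hv u hu)))
  calc _ ≤ E * (b - a) * (b - a) := this
    _ = _ := by ring

/-- The function `(Dh)^{-1/2}`, a solution of `y'' = - (S h / 2) y`. -/
noncomputable def invSqrtDeriv (h : ℝ → ℝ) (x : ℝ) : ℝ := Real.exp (-Real.log (deriv h x) / 2)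

lemma invSqrtDeriv_pos (h : ℝ → ℝ) (x : ℝ) : 0 < invSqrtDeriv h x := Real.exp_pos _

lemma invSqrtDeriv_sq (hpos : ∀ x, 0 < deriv h x) (x : ℝ) :
    invSqrtDeriv h x ^ 2 = (deriv h x)⁻¹ := by
  rw [invSqrtDeriv, ← Real.exp_nat_mul, ← Real.exp_log (inv_pos.2 (hpos x)), Real.log_inv]
  congr 1
  push_cast
  ring

lemma hasDerivAt_invSqrtDeriv (hh : ContDiff ℝ (3 : ℕ) h) (hpos : ∀ x, 0 < deriv h x) (x : ℝ) :
    HasDerivAt (invSqrtDeriv h) (-(nonlin h x / 2) * invSqrtDeriv h x) x := by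
  have := ((hasDerivAt_log_deriv hh hpos x).neg.div_const 2).exp
  refine this.congr_deriv ?_
  simp only [invSqrtDeriv, Pi.neg_apply]
  ring

lemma hasDerivAt_invSqrtDeriv' (hh : ContDiff ℝ (3 : ℕ) h) (hpos : ∀ x, 0 < deriv h x) (x : ℝ) :
    HasDerivAt (fun x => -(nonlin h x / 2) * invSqrtDeriv h x)
      (-(schw h x / 2) * invSqrtDeriv h x) x := by
  have := ((hasDerivAt_nonlin hh hpos x).div_const 2).neg.mul (hasDerivAt_invSqrtDeriv hh hpos x)
  refine this.congr_deriv ?_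
  simp only [Pi.neg_apply]
  ring

/-- If the Schwarzian derivative of `h` is at most `σ` and the distortion of `h` is at most `D`
on `[a, b]`, then `h` is close to a Möbius map there: the three identities which relate the
derivatives and the nonlinearities of a Möbius map at two points hold up to `O(σ (b - a)²)`. -/
lemma moebius_approx (hh : ContDiff ℝ (3 : ℕ) h) (hpos : ∀ x, 0 < deriv h x) {a b σ D : ℝ}
    (hab : a < b) (hD : ∀ s ∈ Icc a b, ∀ t ∈ Icc a b, deriv h s ≤ D ^ 2 * deriv h t) (hD1 : 1 ≤ D)
    (hσ : ∀ t ∈ Icc a b, |schw h t| ≤ σ) :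
    |invSqrtDeriv h b / invSqrtDeriv h a - 1 + nonlin h a * (b - a) / 2| ≤ D ^ 4 * σ * (b - a) ^ 2 ∧
    |invSqrtDeriv h a / invSqrtDeriv h b - 1 - nonlin h b * (b - a) / 2|
      ≤ D ^ 4 * σ * (b - a) ^ 2 ∧
    |(h b - h a) / (b - a) * (invSqrtDeriv h a * invSqrtDeriv h b) - 1|
      ≤ D ^ 4 * σ * (b - a) ^ 2 := by
  set y := invSqrtDeriv h with hy
  have yp : ∀ t, 0 < y t := invSqrtDeriv_pos h
  have ha : a ∈ Icc a b := left_mem_Icc.2 hab.le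
  have hb : b ∈ Icc a b := right_mem_Icc.2 hab.le
  have hσ0 : 0 ≤ σ := (abs_nonneg _).trans (hσ a ha)
  have hD0 : 0 < D := by linarith
  have hl : 0 < b - a := sub_pos.2 hab
  have ysq : ∀ t, deriv h t = (y t ^ 2)⁻¹ := fun t => by
    rw [hy, invSqrtDeriv_sq hpos, inv_inv]
  have hyD : ∀ s ∈ Icc a b, ∀ t ∈ Icc a b, y s ≤ D * y t := by
    intro s hs t ht
    have h1 := hD t ht s hs
    rw [ysq, ysq, ← div_eq_mul_inv, inv_eq_one_div, div_le_div_iff₀ (by have := yp t; positivity)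
      (by have := yp s; positivity)] at h1
    refine le_of_sq_le_sq ?_ (mul_nonneg hD0.le (yp t).le)
    rw [mul_pow]; linarith
  have key : ∀ u ∈ Icc a b, ∀ v ∈ Icc a b,
      |y v / y u - 1 + nonlin h u * (v - u) / 2| ≤ D * σ * (b - a) ^ 2 := by
    intro u hu v hv
    have h1 := abs_taylor_one_le (E := σ * (D * y u)) (hasDerivAt_invSqrtDeriv hh hpos)
      (hasDerivAt_invSqrtDeriv' hh hpos) (a := a) (b := b) (u := u) (v := v) (fun t ht => by
        rw [abs_mul, abs_neg, abs_of_pos (invSqrtDeriv_pos h t), abs_div, abs_two]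
        refine mul_le_mul ?_ (hyD t ht u hu) (yp t).le hσ0
        linarith [hσ t ht, abs_nonneg (schw h t)]) hu hv
    have h2 : y v / y u - 1 + nonlin h u * (v - u) / 2 =
        (y v - y u - -(nonlin h u / 2) * y u * (v - u)) / y u := by
      have := (yp u).ne'
      field_simp
      ring
    rw [h2, abs_div, abs_of_pos (yp u), div_le_iff₀ (yp u)]
    refine h1.trans (le_of_eq ?_)
    ring
  have hpow : D * σ * (b - a) ^ 2 ≤ D ^ 4 * σ * (b - a) ^ 2 := by
    have : D ≤ D ^ 4 := le_self_pow₀ hD1 (by norm_num)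
    gcongr
  refine ⟨(key a ha b hb).trans hpow, ?_, ?_⟩
  · refine le_trans (le_of_eq ?_) ((key b hb a ha).trans hpow)
    congr 1
    ring
  · -- `(h - h a) y` is a second solution of the same linear equation
    have hv1 : ∀ t, HasDerivAt (fun t => (h t - h a) * y t)
        ((y t)⁻¹ + (h t - h a) * (-(nonlin h t / 2) * y t)) t := fun t => by
      have := ((hasDerivAt_of_contDiff hh (by norm_num) t).sub_const (h a)).mul
        (hasDerivAt_invSqrtDeriv hh hpos t)
      refine this.congr_deriv ?_
      rw [ysq t, ← hy]
      have := (yp t).ne'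
      field_simp
    have hv2 : ∀ t, HasDerivAt (fun t => (y t)⁻¹ + (h t - h a) * (-(nonlin h t / 2) * y t))
        ((h t - h a) * (-(schw h t / 2) * y t)) t := fun t => by
      have := ((hasDerivAt_invSqrtDeriv hh hpos t).inv (yp t).ne').add
        (((hasDerivAt_of_contDiff hh (by norm_num) t).sub_const (h a)).mul
        (hasDerivAt_invSqrtDeriv' hh hpos t))
      refine this.congr_deriv ?_
      rw [ysq t, ← hy]
      have := (yp t).ne'
      field_simp
      ring
    have hmono : StrictMono h := strictMono_of_deriv_pos hpos
    -- mean value theorem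
    obtain ⟨ξ, hξ, hξ'⟩ := exists_deriv_eq_slope h hab hh.continuous.continuousOn
      (hh.differentiable (by norm_num)).differentiableOn
    have hξm := Ioo_subset_Icc_self hξ
    have hslope : (h b - h a) = deriv h ξ * (b - a) := by
      rw [hξ']; field_simp
    have h1 := abs_taylor_one_le (E := (deriv h ξ * (b - a)) * (σ * (D * y a))) hv1 hv2
      (a := a) (b := b) (u := a) (v := b) (fun t ht => by
        rw [abs_mul, abs_mul, abs_neg, abs_of_pos (yp t), abs_div, abs_two,
          abs_of_nonneg (sub_nonneg.2 (hmono.monotone ht.1))]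
        have e1 : h t - h a ≤ deriv h ξ * (b - a) := by
          rw [← hslope]; linarith [hmono.monotone ht.2]
        have e2 : |schw h t| / 2 * y t ≤ σ * (D * y a) := by
          refine mul_le_mul ?_ (hyD t ht a ha) (yp t).le hσ0
          linarith [hσ t ht, abs_nonneg (schw h t)]
        refine mul_le_mul e1 e2 ?_ ?_
        · have := yp t; positivity
        · have := hpos ξ; positivity) ha hb
    have h2 : (h b - h a) / (b - a) * (y a * y b) - 1 =
        ((h b - h a) * y b - (h a - h a) * y a -
          ((y a)⁻¹ + (h a - h a) * (-(nonlin h a / 2) * y a)) * (b - a)) * (y a / (b - a)) := by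
      have := (yp a).ne'
      have := hl.ne'
      field_simp
      ring
    rw [h2, abs_mul, abs_of_pos (div_pos (yp a) hl), ← le_div_iff₀ (div_pos (yp a) hl)]
    refine h1.trans ?_
    rw [le_div_iff₀ (div_pos (yp a) hl)]
    have e3 : deriv h ξ * (y a * y a) ≤ D ^ 2 := by
      rw [ysq, inv_mul_le_iff₀ (by have := yp ξ; positivity)]
      have := hyD a ha ξ hξm
      have h3 := mul_le_mul this this (yp a).le (mul_nonneg hD0.le (yp ξ).le)
      linarith
    calc deriv h ξ * (b - a) * (σ * (D * y a)) * (b - a) ^ 2 * (y a / (b - a))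
        = (deriv h ξ * (y a * y a)) * (D * σ * (b - a) ^ 2) := by field_simp
      _ ≤ D ^ 2 * (D * σ * (b - a) ^ 2) := by gcongr
      _ = D ^ 3 * (σ * (b - a) ^ 2) := by ring
      _ ≤ D ^ 4 * (σ * (b - a) ^ 2) := by
          have : D ^ 3 ≤ D ^ 4 := pow_le_pow_right₀ hD1 (by norm_num)
          gcongr
      _ = _ := by ring

end

section
variable {g h : ℝ → ℝ}

/-! ### The trace of the Möbius map osculating a commuting diffeomorphism -/

/-- The normalised trace of the Möbius map with the same 2-jet as `g` at `x`. It is constant when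
`g` is a Möbius map, and invariant under conjugation by Möbius maps. -/
noncomputable def moebTrace (g : ℝ → ℝ) (x : ℝ) : ℝ :=
  (1 + deriv g x - (g x - x) * nonlin g x / 2) * invSqrtDeriv g x

lemma hasDerivAt_moebTrace (hg : ContDiff ℝ (3 : ℕ) g) (hpos : ∀ x, 0 < deriv g x) (x : ℝ) :
    HasDerivAt (moebTrace g) (-((g x - x) * schw g x / 2) * invSqrtDeriv g x) x := by
  have h1 := (((hasDerivAt_deriv hg hpos x).const_add 1).sub
    ((((hasDerivAt_of_contDiff hg (by norm_num) x).sub (hasDerivAt_id x)).mul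
      (hasDerivAt_nonlin hg hpos x)).div_const 2)).mul (hasDerivAt_invSqrtDeriv hg hpos x)
  refine h1.congr_deriv ?_
  simp only [Pi.sub_apply, Pi.mul_apply, id]
  ring

/-- The trace is almost invariant under a diffeomorphism `h` commuting with `g` which is close to a
Möbius map on `[x, g x]`. -/
lemma abs_moebTrace_comp_sub_le (hg : ContDiff ℝ (3 : ℕ) g) (hgpos : ∀ x, 0 < deriv g x)
    (hh : ContDiff ℝ (3 : ℕ) h) (hhpos : ∀ x, 0 < deriv h x) (hcomm : g ∘ h = h ∘ g) {x ε : ℝ}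
    (hx : x < g x)
    (h1 : |invSqrtDeriv h (g x) / invSqrtDeriv h x - 1 + nonlin h x * (g x - x) / 2| ≤ ε)
    (h2 : |invSqrtDeriv h x / invSqrtDeriv h (g x) - 1 - nonlin h (g x) * (g x - x) / 2| ≤ ε)
    (h3 : |(h (g x) - h x) / (g x - x) * (invSqrtDeriv h x * invSqrtDeriv h (g x)) - 1| ≤ ε) :
    |moebTrace g (h x) - moebTrace g x| ≤ ε * invSqrtDeriv g x *
      (1 + deriv g x + |nonlin g x * (g x - x) / 2| +
        |nonlin h (g x) * (g x - x) / 2| * deriv g x + |nonlin h x * (g x - x) / 2|) := by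
  have hl : 0 < g x - x := sub_pos.2 hx
  have e1 : deriv g (h x) * deriv h x = deriv h (g x) * deriv g x := by
    rw [← deriv_comp_eq hg hh, ← deriv_comp_eq hh hg, hcomm]
  have e2 : nonlin g (h x) * deriv h x + nonlin h x = nonlin h (g x) * deriv g x + nonlin g x := by
    rw [← nonlin_comp hg hh hgpos hhpos, ← nonlin_comp hh hg hhpos hgpos, hcomm]
  have e3 : g (h x) = h (g x) := congrFun hcomm x
  have ya := invSqrtDeriv_pos h x
  have yb := invSqrtDeriv_pos h (g x)
  have yg := invSqrtDeriv_pos g x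
  have yg' := invSqrtDeriv_pos g (h x)
  have sa := invSqrtDeriv_sq hhpos x
  have sb := invSqrtDeriv_sq hhpos (g x)
  have sg := invSqrtDeriv_sq hgpos x
  have sg' := invSqrtDeriv_sq hgpos (h x)
  have G0 := hgpos x
  have A0 := hhpos x
  have B0 := hhpos (g x)
  have G0' := hgpos (h x)
  set y₁ := invSqrtDeriv h x
  set y₂ := invSqrtDeriv h (g x)
  set z := invSqrtDeriv g x
  set z' := invSqrtDeriv g (h x)
  set G := deriv g x
  set l := g x - x
  have hz' : z' = z * y₂ / y₁ := by
    have : z' ^ 2 = (z * y₂ / y₁) ^ 2 := by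
      rw [div_pow, mul_pow, sg', sg, sb, sa]
      field_simp
      linarith
    exact (pow_left_inj₀ yg'.le (by positivity) two_ne_zero).1 this
  have hA : deriv h x = (y₁ ^ 2)⁻¹ := by rw [sa, inv_inv]
  have hB : deriv h (g x) = (y₂ ^ 2)⁻¹ := by rw [sb, inv_inv]
  have hG' : deriv g (h x) = G * (y₁ / y₂) ^ 2 := by
    rw [hA, hB] at e1
    field_simp at e1 ⊢
    linarith
  have hN' : nonlin g (h x) = (nonlin h (g x) * G + nonlin g x - nonlin h x) * y₁ ^ 2 := by
    rw [hA] at e2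
    field_simp at e2 ⊢
    linarith
  have main : moebTrace g (h x) - moebTrace g x = z *
      ((y₂ / y₁ - 1 + nonlin h x * l / 2) + G * (y₁ / y₂ - 1 - nonlin h (g x) * l / 2)
        - ((h (g x) - h x) / l * (y₁ * y₂) - 1) *
          (nonlin g x * l / 2 + nonlin h (g x) * l / 2 * G - nonlin h x * l / 2)) := by
    have l0 := hl.ne'
    change (1 + deriv g (h x) - (g (h x) - h x) * nonlin g (h x) / 2) * z' -
      (1 + G - l * nonlin g x / 2) * z = _
    rw [e3, hG', hN', hz']
    field_simp
    ring
  have hε : 0 ≤ ε := (abs_nonneg _).trans h1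
  rw [main, abs_mul, abs_of_pos yg]
  have b1 := abs_sub (((y₂ / y₁ - 1 + nonlin h x * l / 2)) +
    G * (y₁ / y₂ - 1 - nonlin h (g x) * l / 2)) (((h (g x) - h x) / l * (y₁ * y₂) - 1) *
          (nonlin g x * l / 2 + nonlin h (g x) * l / 2 * G - nonlin h x * l / 2))
  have b2 := abs_add_le ((y₂ / y₁ - 1 + nonlin h x * l / 2))
    (G * (y₁ / y₂ - 1 - nonlin h (g x) * l / 2))
  have b3 := abs_sub (nonlin g x * l / 2 + nonlin h (g x) * l / 2 * G) (nonlin h x * l / 2)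
  have b4 := abs_add_le (nonlin g x * l / 2) (nonlin h (g x) * l / 2 * G)
  rw [abs_mul] at b1
  rw [abs_mul, abs_of_pos G0] at b2
  rw [abs_mul (nonlin h (g x) * l / 2) G, abs_of_pos G0] at b4
  have b5 := mul_le_mul h3 (b3.trans (add_le_add_left b4 _)) (abs_nonneg _) hε
  have b6 := mul_le_mul_of_nonneg_left h2 G0.le
  rw [mul_comm ε z, mul_assoc]
  refine mul_le_mul_of_nonneg_left ?_ yg.le
  linarith

end

/-! ### Bounds for iterated derivatives at a point -/

/-- The derivatives of `u` at `x` of order `j ≤ s` are bounded by `A * B ^ j`. -/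
def JetBound (u : ℝ → ℝ) (x : ℝ) (s : ℕ) (A B : ℝ) : Prop :=
  ∀ j ≤ s, |iteratedDeriv j u x| ≤ A * B ^ j

section
variable {u v h : ℝ → ℝ} {x A A' B : ℝ} {s : ℕ}

lemma JetBound.mono_order {t : ℕ} (hu : JetBound u x s A B) (hts : t ≤ s) : JetBound u x t A B :=
  fun j hj => hu j (hj.trans hts)

lemma JetBound.mono_const (hu : JetBound u x s A B) (hA : A ≤ A') (hB : 0 ≤ B) :
    JetBound u x s A' B :=
  fun j hj => (hu j hj).trans (mul_le_mul_of_nonneg_right hA (pow_nonneg hB j))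

lemma JetBound.nonneg (hu : JetBound u x s A B) : 0 ≤ A := by
  simpa using (abs_nonneg _).trans (hu 0 (Nat.zero_le s))

lemma JetBound.succ (h0 : |u x| ≤ A) (h1 : JetBound (deriv u) x s (A * B) B) :
    JetBound u x (s + 1) A B := by
  intro j hj
  cases j with
  | zero => simpa using h0
  | succ j =>
    rw [iteratedDeriv_succ']
    refine (h1 j (by omega)).trans (le_of_eq ?_)
    ring

lemma JetBound.mul (hu : JetBound u x s A B) (hv : JetBound v x s A' B) (hB : 0 ≤ B)
    (cu : ContDiff ℝ s u) (cv : ContDiff ℝ s v) :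
    JetBound (fun y => u y * v y) x s (2 ^ s * A * A') B := by
  intro j hj
  have hA := hu.nonneg
  have hA' := hv.nonneg
  have h1 := norm_iteratedFDeriv_mul_le cu cv x (n := j) (by exact_mod_cast hj)
  simp only [norm_iteratedFDeriv_eq_norm_iteratedDeriv, Real.norm_eq_abs] at h1
  refine h1.trans ?_
  have h2 : ∀ i ∈ Finset.range (j + 1), (j.choose i : ℝ) * |iteratedDeriv i u x| *
      |iteratedDeriv (j - i) v x| ≤ (j.choose i : ℝ) * (A * A' * B ^ j) := by
    intro i hi
    have hij : i ≤ j := Nat.lt_succ_iff.1 (Finset.mem_range.1 hi)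
    have e1 := hu i (hij.trans hj)
    have e2 := hv (j - i) ((Nat.sub_le j i).trans hj)
    rw [mul_assoc]
    refine mul_le_mul_of_nonneg_left ?_ (Nat.cast_nonneg _)
    calc _ ≤ (A * B ^ i) * (A' * B ^ (j - i)) :=
          mul_le_mul e1 e2 (abs_nonneg _) (by positivity)
      _ = A * A' * (B ^ i * B ^ (j - i)) := by ring
      _ = A * A' * B ^ j := by rw [← pow_add, Nat.add_sub_cancel' hij]
  refine (Finset.sum_le_sum h2).trans ?_
  rw [← Finset.sum_mul]
  have h3 : (∑ i ∈ Finset.range (j + 1), (j.choose i : ℝ)) = 2 ^ j := by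
    exact_mod_cast Nat.sum_range_choose j
  have h4 : (2 : ℝ) ^ j ≤ 2 ^ s := pow_le_pow_right₀ one_le_two hj
  rw [h3]
  calc (2 : ℝ) ^ j * (A * A' * B ^ j) ≤ 2 ^ s * (A * A' * B ^ j) := by gcongr
    _ = _ := by ring

lemma JetBound.sum {ι : Type*} {I : Finset ι} {u : ι → ℝ → ℝ} {A : ι → ℝ}
    (hu : ∀ i ∈ I, JetBound (u i) x s (A i) B) (cu : ∀ i ∈ I, ContDiff ℝ s (u i)) :
    JetBound (fun y => ∑ i ∈ I, u i y) x s (∑ i ∈ I, A i) B := by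
  intro j hj
  rw [iteratedDeriv_fun_sum fun i hi => ((cu i hi).of_le (by exact_mod_cast hj)).contDiffAt,
    Finset.sum_mul]
  exact (Finset.abs_sum_le_sum_abs _ _).trans (Finset.sum_le_sum fun i hi => hu i hi j hj)

lemma JetBound.add (hu : JetBound u x s A B) (hv : JetBound v x s A' B)
    (cu : ContDiff ℝ s u) (cv : ContDiff ℝ s v) :
    JetBound (fun y => u y + v y) x s (A + A') B := by
  intro j hj
  have := iteratedDeriv_add ((cu.of_le (by exact_mod_cast hj : (j : WithTop ℕ∞) ≤ s)).contDiffAt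
    (x := x)) ((cv.of_le (by exact_mod_cast hj : (j : WithTop ℕ∞) ≤ s)).contDiffAt)
  change |iteratedDeriv j (u + v) x| ≤ _
  rw [this, add_mul]
  exact (abs_add_le _ _).trans (add_le_add (hu j hj) (hv j hj))

/-- Bounds on the derivatives of the nonlinearity bound those of `Dh`, relatively to `Dh x`. -/
lemma exists_jetBound_deriv (s : ℕ) (A : ℝ) : ∃ C : ℝ, 0 ≤ C ∧
    ∀ (h : ℝ → ℝ) (n : ℕ) (x B : ℝ), ContDiff ℝ n h → (∀ x, 0 < deriv h x) → s + 2 ≤ n → 3 ≤ n →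
      0 ≤ B → JetBound (nonlin h) x s (A * B) B →
      JetBound (deriv h) x (s + 1) (C * deriv h x) B := by
  have step : ∀ (t : ℕ) (K : ℝ), 0 ≤ K → ∀ (h : ℝ → ℝ) (n : ℕ) (x B : ℝ), ContDiff ℝ n h →
      (∀ x, 0 < deriv h x) → t + 2 ≤ n → 3 ≤ n → 0 ≤ B → JetBound (nonlin h) x t (A * B) B →
      JetBound (deriv h) x t (K * deriv h x) B →
      JetBound (deriv h) x (t + 1) (max 1 (2 ^ t * K * A) * deriv h x) B := by
    intro t K hK h n x B hh hpos htn h3 hB hN hD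
    have hx := hpos x
    refine JetBound.succ ?_ ?_
    · rw [abs_of_pos hx]
      exact le_mul_of_one_le_left hx.le (le_max_left _ _)
    · have e : deriv (deriv h) = fun y => deriv h y * nonlin h y := funext fun y =>
        (hasDerivAt_deriv (hh.of_le (by exact_mod_cast h3)) hpos y).deriv
      rw [e]
      refine (hD.mul hN hB (contDiff_deriv_of_succ hh (by omega))
        (contDiff_nonlin hh hpos htn)).mono_const ?_ hB
      calc _ = (2 ^ t * K * A) * (deriv h x * B) := by ring
        _ ≤ max 1 (2 ^ t * K * A) * (deriv h x * B) := by
            gcongr; exact le_max_right _ _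
        _ = _ := by ring
  induction s with
  | zero =>
    refine ⟨_, le_trans zero_le_one (le_max_left 1 (2 ^ 0 * 1 * A)), ?_⟩
    intro h n x B hh hpos hn h3 hB hN
    refine step 0 1 zero_le_one h n x B hh hpos hn h3 hB hN ?_
    intro j hj
    obtain rfl : j = 0 := by omega
    simp [abs_of_pos (hpos x)]
  | succ s ih =>
    obtain ⟨C, hC, ih⟩ := ih
    refine ⟨_, le_trans zero_le_one (le_max_left 1 (2 ^ (s + 1) * C * A)), ?_⟩
    intro h n x B hh hpos hn h3 hB hN
    exact step (s + 1) C hC h n x B hh hpos hn h3 hB hN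
      (ih h n x B hh hpos (by omega) h3 hB (hN.mono_order (Nat.le_succ s)))

/-- Jets of a composition, when the outer function has bounded derivatives. -/
lemma exists_jetBound_comp (s : ℕ) {A : ℝ} (A' : ℝ) (hA : 0 ≤ A) : ∃ C : ℝ, 0 ≤ C ∧
    ∀ (u h : ℝ → ℝ) (x B : ℝ), ContDiff ℝ s u → ContDiff ℝ (s + 1 : ℕ) h → 0 ≤ B →
      (∀ j ≤ s, ∀ y, |iteratedDeriv j u y| ≤ A) → JetBound (deriv h) x s (A' * B) B →
      JetBound (fun y => u (h y)) x s C B := by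
  induction s with
  | zero =>
    refine ⟨A, hA, ?_⟩
    intro u h x B _ _ _ hu _ j hj
    obtain rfl : j = 0 := by omega
    simpa using hu 0 le_rfl (h x)
  | succ s ih =>
    obtain ⟨C, hC, ih⟩ := ih
    refine ⟨max A (2 ^ s * C * A'), hA.trans (le_max_left _ _), ?_⟩
    intro u h x B cu ch hB hu hD
    refine JetBound.succ ?_ ?_
    · exact (by simpa using hu 0 (Nat.zero_le _) (h x) : |u (h x)| ≤ A).trans (le_max_left _ _)
    · have e : deriv (fun y => u (h y)) = fun y => deriv u (h y) * deriv h y := funext fun y =>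
        ((hasDerivAt_of_contDiff cu (by omega) (h y)).comp y
          (hasDerivAt_of_contDiff ch (by omega) y)).deriv
      rw [e]
      have cu' : ContDiff ℝ s (deriv u) := contDiff_deriv_of_succ cu le_rfl
      have ch' : ContDiff ℝ (s + 1 : ℕ) h := ch.of_le (by exact_mod_cast Nat.le_succ _)
      have h1 := ih (deriv u) h x B cu' ch' hB (fun j hj y => by
        rw [← iteratedDeriv_succ']
        exact hu (j + 1) (by omega) y) (hD.mono_order (Nat.le_succ s))
      refine (h1.mul (hD.mono_order (Nat.le_succ s)) hB
        (cu'.comp (ch'.of_le (by exact_mod_cast Nat.le_succ s)))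
        (contDiff_deriv_of_succ ch (by omega))).mono_const ?_ hB
      calc _ = (2 ^ s * C * A') * B := by ring
        _ ≤ _ := by gcongr; exact le_max_right _ _

end

/-! ### Interpolation of functions which are almost constant on a well spaced set -/

/-- A function with `m` zeros in `[a, b]` is controlled by its `m`-th derivative. -/
lemma abs_le_of_zeros (m : ℕ) : ∀ (e : ℝ → ℝ) (t : ℕ → ℝ) (a b E : ℝ), ContDiff ℝ m e →
    (∀ i, i + 1 < m → t i < t (i + 1)) → (∀ i < m, t i ∈ Icc a b ∧ e (t i) = 0) →
    (∀ y ∈ Icc a b, |iteratedDeriv m e y| ≤ E) → ∀ y ∈ Icc a b, |e y| ≤ E * (b - a) ^ m := by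
  induction m with
  | zero =>
    intro e t a b E _ _ _ hE y hy
    simpa using hE y hy
  | succ m ih =>
    intro e t a b E he ht ht0 hE y hy
    have he' : ContDiff ℝ m (deriv e) := contDiff_deriv_of_succ he le_rfl
    have hde : ∀ s, HasDerivAt e (deriv e s) s := hasDerivAt_of_contDiff he (by omega)
    -- Rolle's theorem between consecutive zeros
    have hroll : ∀ i, ∃ c, i + 1 < m + 1 → c ∈ Ioo (t i) (t (i + 1)) ∧ deriv e c = 0 := by
      intro i
      by_cases hi : i + 1 < m + 1
      · obtain ⟨c, hc, hc'⟩ := exists_hasDerivAt_eq_zero (ht i hi) he.continuous.continuousOn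
          (by rw [(ht0 i (by omega)).2, (ht0 (i + 1) hi).2]) (fun s _ => hde s)
        exact ⟨c, fun _ => ⟨hc, hc'⟩⟩
      · exact ⟨0, fun h => absurd h hi⟩
    choose c hc using hroll
    have hE' := ih (deriv e) c a b E he'
      (fun i hi => (hc i (by omega)).1.2.trans (hc (i + 1) (by omega)).1.1)
      (fun i hi => ⟨⟨(ht0 i (by omega)).1.1.trans (hc i (by omega)).1.1.le,
        (hc i (by omega)).1.2.le.trans (ht0 (i + 1) (by omega)).1.2⟩, (hc i (by omega)).2⟩)
      (fun y hy => by rw [← iteratedDeriv_succ']; exact hE y hy)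
    have h0 := ht0 0 (by omega)
    have h1 := (convex_Icc a b).norm_image_sub_le_of_norm_hasDerivWithin_le
      (fun s _ => (hde s).hasDerivWithinAt) hE' h0.1 hy
    rw [h0.2, sub_zero] at h1
    refine h1.trans ?_
    have h2 : ‖y - t 0‖ ≤ b - a := by
      rw [Real.norm_eq_abs, abs_le]
      constructor <;> linarith [hy.1, hy.2, h0.1.1, h0.1.2]
    have h3 : 0 ≤ E * (b - a) ^ m := (abs_nonneg _).trans (hE' y hy)
    calc _ ≤ E * (b - a) ^ m * (b - a) := mul_le_mul_of_nonneg_left h2 h3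
      _ = _ := by ring

lemma iteratedDeriv_polynomial_eval (P : Polynomial ℝ) (m : ℕ) :
    iteratedDeriv m (fun y => P.eval y) = fun y => (Polynomial.derivative^[m] P).eval y := by
  induction m with
  | zero => simp
  | succ m ih =>
    rw [iteratedDeriv_succ, ih]
    funext y
    rw [Function.iterate_succ_apply', Polynomial.deriv]

/-- If `ψ` is close to `c` at `m` points of `[a, b]` with gaps at least `d`, and its `m`-th
derivative is small, then `ψ` is close to `c` on `[a, b]`. -/
lemma abs_sub_le_of_nodes {m : ℕ} {ψ : ℝ → ℝ} {t : ℕ → ℝ} {a b c d E ε : ℝ}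
    (hm : 0 < m) (hψ : ContDiff ℝ m ψ) (hd : 0 < d) (hab : a < b)
    (ht : ∀ i, i + 1 < m → t i + d ≤ t (i + 1))
    (htab : ∀ i < m, t i ∈ Icc a b) (htc : ∀ i < m, |ψ (t i) - c| ≤ ε)
    (hE : ∀ y ∈ Icc a b, |iteratedDeriv m ψ y| ≤ E) {y : ℝ} (hy : y ∈ Icc a b) :
    |ψ y - c| ≤ m * ((b - a) / d) ^ (m - 1) * ε + E * (b - a) ^ m := by
  have gap : ∀ i j, i < j → j < m → d ≤ t j - t i := by
    intro i j hij
    induction j, hij using Nat.le_induction with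
    | base => intro h; linarith [ht i h]
    | succ j hj ih => intro h; linarith [ih (by omega), ht j h]
  have gap' : ∀ i < m, ∀ j < m, i ≠ j → d ≤ |t i - t j| := by
    intro i hi j hj hij
    rcases lt_or_gt_of_ne hij with h | h
    · rw [abs_sub_comm]; exact (gap i j h hj).trans (le_abs_self _)
    · exact (gap j i h hi).trans (le_abs_self _)
  have hinj : Set.InjOn t (Finset.range m : Set ℕ) := by
    intro i hi j hj hij
    by_contra hne
    have := gap' i (by simpa using hi) j (by simpa using hj) hne
    rw [hij, sub_self, abs_zero] at this
    linarith
  set P := Lagrange.interpolate (Finset.range m) t (fun i => ψ (t i) - c) with hP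
  have hdeg : P.degree < m := by
    have := Lagrange.degree_interpolate_lt (fun i => ψ (t i) - c) hinj
    rwa [Finset.card_range] at this
  have hPt : ∀ i < m, P.eval (t i) = ψ (t i) - c := fun i hi =>
    Lagrange.eval_interpolate_at_node _ hinj (by simpa using hi)
  have hPd : iteratedDeriv m (fun y => P.eval y) = fun _ => 0 := by
    rw [iteratedDeriv_polynomial_eval, Polynomial.iterate_derivative_eq_zero_of_degree_lt hdeg]
    simp
  have hPc : ContDiff ℝ m (fun y => P.eval y) := by
    simpa using Polynomial.contDiff_aeval (𝕜 := ℝ) P m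
  have h1 : |ψ y - c - P.eval y| ≤ E * (b - a) ^ m := by
    refine abs_le_of_zeros m (fun y => ψ y - c - P.eval y) t a b E
      ((hψ.sub contDiff_const).sub hPc) (fun i hi => by linarith [ht i hi])
      (fun i hi => ⟨htab i hi, by simp [hPt i hi]⟩) (fun z hz => ?_) y hy
    have e : (fun y => ψ y - c - P.eval y) = (ψ - fun y => c + P.eval y) := by
      funext w; simp; ring
    have e2 : iteratedDeriv m (fun y => ψ y - c - P.eval y) z =
        iteratedDeriv m ψ z := by
      rw [e, iteratedDeriv_sub hψ.contDiffAt (contDiff_const.add hPc).contDiffAt]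
      rw [iteratedDeriv_const_add hm, hPd, sub_zero]
    rw [e2]
    exact hE z hz
  have h2 : |P.eval y| ≤ m * ((b - a) / d) ^ (m - 1) * ε := by
    rw [hP, Lagrange.interpolate_apply, Polynomial.eval_finsetSum]
    refine (Finset.abs_sum_le_sum_abs _ _).trans ?_
    have : ∀ i ∈ Finset.range m, |Polynomial.eval y (Polynomial.C (ψ (t i) - c) *
        Lagrange.basis (Finset.range m) t i)| ≤ ((b - a) / d) ^ (m - 1) * ε := by
      intro i hi
      have him := Finset.mem_range.1 hi
      rw [Polynomial.eval_mul, Polynomial.eval_C, abs_mul, mul_comm]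
      refine mul_le_mul ?_ (htc i him) (abs_nonneg _) (by have := sub_pos.2 hab; positivity)
      rw [Lagrange.basis, Polynomial.eval_prod, Finset.abs_prod]
      have hcard : ((Finset.range m).erase i).card = m - 1 := by
        rw [Finset.card_erase_of_mem hi, Finset.card_range]
      rw [← hcard, ← Finset.prod_const]
      refine Finset.prod_le_prod (fun _ _ => abs_nonneg _) (fun j hj => ?_)
      obtain ⟨hji, hj⟩ := Finset.mem_erase.1 hj
      have hjm := Finset.mem_range.1 hj
      simp only [Lagrange.basisDivisor, Polynomial.eval_mul, Polynomial.eval_C,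
        Polynomial.eval_sub, Polynomial.eval_X]
      rw [abs_mul, abs_inv, mul_comm, ← div_eq_mul_inv]
      have hg := gap' i him j hjm (Ne.symm hji)
      refine div_le_div₀ (sub_pos.2 hab).le ?_ hd hg
      rw [abs_le]
      constructor <;> linarith [hy.1, hy.2, (htab j hjm).1, (htab j hjm).2]
    refine (Finset.sum_le_sum this).trans (le_of_eq ?_)
    rw [Finset.sum_const, Finset.card_range, nsmul_eq_mul, mul_assoc]
  calc |ψ y - c| = |P.eval y + (ψ y - c - P.eval y)| := by congr 1; ring
    _ ≤ _ := (abs_add_le _ _).trans (add_le_add h2 h1)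

/-! ### Iterates of a smooth lift -/

/-- `F` is a lift to the line of an orientation preserving `C^k` diffeomorphism of the circle, with
`k ≥ 3`. -/
structure IsSmoothLift (k : ℕ) (F : ℝ → ℝ) : Prop where
  three_le : 3 ≤ k
  contDiff : ContDiff ℝ k F
  deriv_pos : ∀ x, 0 < deriv F x
  map_add_one : ∀ x, F (x + 1) = F x + 1

/-- The lift `x ↦ F^q x - p` of the `q`-th iterate of the circle map. -/
def liftIter (F : ℝ → ℝ) (q : ℕ) (p : ℤ) (x : ℝ) : ℝ := F^[q] x - p

lemma iterate_add_int {F : ℝ → ℝ} (hF : ∀ x, F (x + 1) = F x + 1) (i : ℕ) (b : ℤ) (x : ℝ) :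
    F^[i] (x + b) = F^[i] x + b := by
  have h1 : ∀ x, F^[i] (x + 1) = F^[i] x + 1 := by
    induction i with
    | zero => intro x; rfl
    | succ i ih => intro x; rw [Function.iterate_succ_apply, hF, ih, Function.iterate_succ_apply]
  have h2 : Function.Periodic (fun x => F^[i] x - x) 1 := fun x => by simp only [h1]; ring
  have h3 := h2.int_mul b x
  simp only [mul_one] at h3
  linarith

lemma exists_bound_of_periodic {u : ℝ → ℝ} (hu : Continuous u) (hp : ∀ x, u (x + 1) = u x) :
    ∃ C, 0 ≤ C ∧ ∀ x, |u x| ≤ C := by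
  obtain ⟨C, hC⟩ := isCompact_Icc.exists_bound_of_continuousOn (s := Icc (0 : ℝ) 1) hu.continuousOn
  have h : ∀ x, |u x| ≤ C := fun x => by
    obtain ⟨y, hy, hxy⟩ := Function.Periodic.exists_mem_Ico₀ (f := u) (c := 1) hp one_pos x
    rw [hxy]
    exact hC y (Ico_subset_Icc_self hy)
  exact ⟨C, (abs_nonneg _).trans (h 0), h⟩

lemma exists_isMinOn_of_periodic {u : ℝ → ℝ} (hu : Continuous u) (hp : ∀ x, u (x + 1) = u x) :
    ∃ z, ∀ x, u z ≤ u x := by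
  obtain ⟨z, -, hz⟩ := isCompact_Icc.exists_isMinOn (s := Icc (0 : ℝ) 1)
    (nonempty_Icc.2 zero_le_one) hu.continuousOn
  refine ⟨z, fun x => ?_⟩
  obtain ⟨y, hy, hxy⟩ := Function.Periodic.exists_mem_Ico₀ (f := u) (c := 1) hp one_pos x
  rw [hxy]
  exact hz (Ico_subset_Icc_self hy)

lemma deriv_add_one {u : ℝ → ℝ} {c : ℝ} (hp : ∀ x, u (x + 1) = u x + c) (x : ℝ) :
    deriv u (x + 1) = deriv u x := by
  rw [← deriv_comp_add_const u 1 x, show (fun x => u (x + 1)) = fun x => u x + c from funext hp,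
    deriv_add_const]

namespace IsSmoothLift

variable {k : ℕ} {F : ℝ → ℝ} (hF : IsSmoothLift k F)
include hF

lemma contDiff_three : ContDiff ℝ (3 : ℕ) F := hF.contDiff.of_le (by exact_mod_cast hF.three_le)

lemma contDiff_iterate (i : ℕ) : ContDiff ℝ k F^[i] := by
  induction i with
  | zero => exact contDiff_id
  | succ i ih => rw [Function.iterate_succ']; exact hF.contDiff.comp ih

lemma contDiff_three_iterate (i : ℕ) : ContDiff ℝ (3 : ℕ) F^[i] :=
  (hF.contDiff_iterate i).of_le (by exact_mod_cast hF.three_le)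

lemma deriv_iterate_succ (i : ℕ) (x : ℝ) :
    deriv F^[i + 1] x = deriv F (F^[i] x) * deriv F^[i] x := by
  rw [Function.iterate_succ', deriv_comp_eq hF.contDiff_three (hF.contDiff_three_iterate i)]

lemma deriv_iterate_pos (i : ℕ) : ∀ x, 0 < deriv F^[i] x := by
  induction i with
  | zero => intro x; simp
  | succ i ih =>
    intro x
    rw [hF.deriv_iterate_succ]
    exact mul_pos (hF.deriv_pos _) (ih x)

lemma iterate_strictMono (i : ℕ) : StrictMono F^[i] :=
  strictMono_of_deriv_pos (hF.deriv_iterate_pos i)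

lemma log_deriv_iterate (l : ℕ) (x : ℝ) :
    Real.log (deriv F^[l] x) = ∑ i ∈ Finset.range l, Real.log (deriv F (F^[i] x)) := by
  induction l with
  | zero => simp
  | succ l ih =>
    rw [hF.deriv_iterate_succ, Real.log_mul (hF.deriv_pos _).ne' (hF.deriv_iterate_pos l x).ne',
      Finset.sum_range_succ, ih, add_comm]

lemma nonlin_iterate (l : ℕ) (x : ℝ) :
    nonlin F^[l] x = ∑ i ∈ Finset.range l, nonlin F (F^[i] x) * deriv F^[i] x := by
  induction l with
  | zero => simp [nonlin]
  | succ l ih =>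
    rw [Function.iterate_succ', nonlin_comp hF.contDiff_three (hF.contDiff_three_iterate l)
      hF.deriv_pos (hF.deriv_iterate_pos l), Finset.sum_range_succ, ih, add_comm]

lemma schw_iterate (l : ℕ) (x : ℝ) :
    schw F^[l] x = ∑ i ∈ Finset.range l, schw F (F^[i] x) * deriv F^[i] x ^ 2 := by
  induction l with
  | zero =>
    have : nonlin (id : ℝ → ℝ) = fun _ => 0 := by funext y; simp [nonlin]
    simp [schw, this]
  | succ l ih =>
    rw [Function.iterate_succ', schw_comp hF.contDiff_three (hF.contDiff_three_iterate l)
      hF.deriv_pos (hF.deriv_iterate_pos l), Finset.sum_range_succ, ih, add_comm]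

lemma nonlin_add_one (x : ℝ) : nonlin F (x + 1) = nonlin F x := by
  have h1 := deriv_add_one hF.map_add_one
  have h2 := deriv_add_one (c := 0) (u := deriv F) (fun x => by rw [h1, add_zero])
  rw [nonlin, nonlin, h1, h2]

lemma schw_add_one (x : ℝ) : schw F (x + 1) = schw F x := by
  have h1 := deriv_add_one (c := 0) (u := nonlin F) (fun x => by rw [hF.nonlin_add_one, add_zero])
  rw [schw, schw, h1, hF.nonlin_add_one]

lemma exists_bound_nonlin_schw : ∃ Λ, 0 ≤ Λ ∧ (∀ x, |nonlin F x| ≤ Λ) ∧ ∀ x, |schw F x| ≤ Λ := by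
  have c1 : ContDiff ℝ (1 : ℕ) (nonlin F) := contDiff_nonlin hF.contDiff hF.deriv_pos hF.three_le
  have c2 : ContDiff ℝ (0 : ℕ) (schw F) := contDiff_schw hF.contDiff hF.deriv_pos hF.three_le
  obtain ⟨A, hA, hA'⟩ := exists_bound_of_periodic c1.continuous hF.nonlin_add_one
  obtain ⟨B, hB, hB'⟩ := exists_bound_of_periodic c2.continuous hF.schw_add_one
  exact ⟨max A B, hA.trans (le_max_left _ _), fun x => (hA' x).trans (le_max_left _ _),
    fun x => (hB' x).trans (le_max_right _ _)⟩

lemma exists_bound_iteratedDeriv_schw (s : ℕ) (hs : s + 3 ≤ k) :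
    ∃ A, 0 ≤ A ∧ ∀ j ≤ s, ∀ y, |iteratedDeriv j (schw F) y| ≤ A := by
  have hper : ∀ j x, iteratedDeriv j (schw F) (x + 1) = iteratedDeriv j (schw F) x := by
    intro j
    induction j with
    | zero => simpa using hF.schw_add_one
    | succ j ih =>
      intro x
      rw [iteratedDeriv_succ]
      exact deriv_add_one (c := 0) (fun x => by rw [ih, add_zero]) x
  have c : ContDiff ℝ s (schw F) := contDiff_schw hF.contDiff hF.deriv_pos hs
  have h1 : ∀ j, ∃ A, 0 ≤ A ∧ (j ≤ s → ∀ y, |iteratedDeriv j (schw F) y| ≤ A) := by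
    intro j
    by_cases hj : j ≤ s
    · obtain ⟨A, hA, hA'⟩ := exists_bound_of_periodic
        (c.continuous_iteratedDeriv j (by exact_mod_cast hj)) (hper j)
      exact ⟨A, hA, fun _ => hA'⟩
    · exact ⟨0, le_rfl, fun h => absurd h hj⟩
  choose A hA hA' using h1
  refine ⟨∑ j ∈ Finset.range (s + 1), A j, Finset.sum_nonneg fun j _ => hA j, fun j hj y => ?_⟩
  exact (hA' j hj y).trans (Finset.single_le_sum (fun j _ => hA j) (Finset.mem_range.2 (by omega)))

lemma contDiff_liftIter (q : ℕ) (p : ℤ) : ContDiff ℝ k (liftIter F q p) :=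
  (hF.contDiff_iterate q).sub contDiff_const

lemma contDiff_three_liftIter (q : ℕ) (p : ℤ) : ContDiff ℝ (3 : ℕ) (liftIter F q p) :=
  (hF.contDiff_liftIter q p).of_le (by exact_mod_cast hF.three_le)

end IsSmoothLift

lemma deriv_liftIter (F : ℝ → ℝ) (q : ℕ) (p : ℤ) : deriv (liftIter F q p) = deriv F^[q] := by
  funext x
  exact deriv_sub_const (p : ℝ)

lemma nonlin_liftIter (F : ℝ → ℝ) (q : ℕ) (p : ℤ) : nonlin (liftIter F q p) = nonlin F^[q] := by
  funext x
  rw [nonlin, nonlin, deriv_liftIter]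

lemma schw_liftIter (F : ℝ → ℝ) (q : ℕ) (p : ℤ) : schw (liftIter F q p) = schw F^[q] := by
  funext x
  rw [schw, schw, nonlin_liftIter]

lemma liftIter_iterate {F : ℝ → ℝ} (hF : ∀ x, F (x + 1) = F x + 1) (q : ℕ) (p : ℤ) (i : ℕ)
    (x : ℝ) : liftIter F q p (F^[i] x) = F^[i] (liftIter F q p x) := by
  have := iterate_add_int hF i (-p) (F^[q] x)
  push_cast at this
  rw [liftIter, liftIter, sub_eq_add_neg, sub_eq_add_neg, this, ← Function.iterate_add_apply,
    ← Function.iterate_add_apply, Nat.add_comm]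

lemma liftIter_add_one {F : ℝ → ℝ} (hF : ∀ x, F (x + 1) = F x + 1) (q : ℕ) (p : ℤ)
    (x : ℝ) : liftIter F q p (x + 1) = liftIter F q p x + 1 := by
  have := iterate_add_int hF q 1 x
  push_cast at this
  rw [liftIter, liftIter, this]
  ring

/-! ### A priori bounds on the dynamical partition -/

/-- The combinatorial information about two consecutive return maps `g = F^q - p` (moving points to
the right by at most `M`) and `e = F^Q - P` (moving points to the left) on which all the
estimates rely: the arcs `F^i [x, g x]`, `i < Q`, have total length at most `1`, and each orbit
segment of length `q + Q` meets each arc `[x, g x]`, modulo `1`. -/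
structure IsCell (F : ℝ → ℝ) (q Q : ℕ) (p P : ℤ) (M : ℝ) : Prop where
  le : q ≤ Q
  lt : ∀ x, x < liftIter F q p x
  sub_le : ∀ x, liftIter F q p x - x ≤ M
  le_one : M ≤ 1
  lt_self : ∀ x, liftIter F Q P x < x
  self_lt : ∀ x, x < liftIter F q p (liftIter F Q P x)
  sum_le : ∀ x, ∑ i ∈ Finset.range Q, (F^[i] (liftIter F q p x) - F^[i] x) ≤ 1
  cover : ∀ z x, ∃ i < q + Q, ∃ b : ℤ, F^[i] z - b ∈ Icc x (liftIter F q p x)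

namespace IsCell

section
variable {k : ℕ} {F : ℝ → ℝ} {q Q : ℕ} {p P : ℤ} {M : ℝ} (hc : IsCell F q Q p P M)
include hc

lemma pos : 0 < M := (sub_pos.2 (hc.lt 0)).trans_le (hc.sub_le 0)

/-- A quantity which varies little along orbit segments of length `Q` and on the arcs `[x, g x]`
varies little on the whole circle. -/
lemma abs_sub_le_of_transport {u : ℝ → ℝ} {a b : ℝ} (hu : ∀ x, u (x + 1) = u x)
    (ha : ∀ l ≤ Q, ∀ x, |u (F^[l] x) - u x| ≤ a)
    (hb : ∀ x, ∀ y ∈ Icc x (liftIter F q p x), |u y - u x| ≤ b) (x z : ℝ) :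
    |u x - u z| ≤ 2 * a + b := by
  obtain ⟨i, hi, m, hm⟩ := hc.cover z x
  have hq := hc.le
  have h1 : u (F^[i] z - m) = u (F^[i] z) := by
    have := (Function.Periodic.sub_int_mul_eq (f := u) (c := 1) hu m (x := F^[i] z))
    simpa using this
  obtain ⟨l₁, l₂, h₁, h₂, rfl⟩ : ∃ l₁ l₂, l₁ ≤ Q ∧ l₂ ≤ Q ∧ i = l₁ + l₂ :=
    ⟨i - min i Q, min i Q, by omega, by omega, by omega⟩
  have h2 := hb x _ hm
  rw [h1, Function.iterate_add_apply] at h2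
  have h3 := ha l₁ h₁ (F^[l₂] z)
  have h4 := ha l₂ h₂ z
  have h5 := _root_.abs_sub_le (u x) (u (F^[l₁] (F^[l₂] z))) (u z)
  have h6 := _root_.abs_sub_le (u (F^[l₁] (F^[l₂] z))) (u (F^[l₂] z)) (u z)
  rw [abs_sub_comm] at h2
  linarith

variable (hF : IsSmoothLift k F)
include hF

variable {Λ : ℝ} (hN : ∀ x, |nonlin F x| ≤ Λ)
include hN

/-- Denjoy's distortion bound. -/
lemma abs_log_deriv_sub_le {l : ℕ} (hl : l ≤ Q) {x s t : ℝ}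
    (hs : s ∈ Icc x (liftIter F q p x)) (ht : t ∈ Icc x (liftIter F q p x)) :
    |Real.log (deriv F^[l] s) - Real.log (deriv F^[l] t)| ≤ Λ := by
  have hΛ : 0 ≤ Λ := (abs_nonneg _).trans (hN 0)
  have hmono := fun i => (hF.iterate_strictMono i).monotone
  rw [hF.log_deriv_iterate, hF.log_deriv_iterate, ← Finset.sum_sub_distrib]
  have h1 : ∀ i ∈ Finset.range l,
      |Real.log (deriv F (F^[i] s)) - Real.log (deriv F (F^[i] t))| ≤
        Λ * (F^[i] (liftIter F q p x) - F^[i] x) := by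
    intro i _
    have h2 := convex_univ.norm_image_sub_le_of_norm_hasDerivWithin_le
      (f := fun y => Real.log (deriv F y)) (C := Λ)
      (fun y _ => (hasDerivAt_log_deriv hF.contDiff_three hF.deriv_pos y).hasDerivWithinAt)
      (fun y _ => hN y) (mem_univ (F^[i] t)) (mem_univ (F^[i] s))
    refine h2.trans (mul_le_mul_of_nonneg_left ?_ hΛ)
    rw [Real.norm_eq_abs, abs_le]
    constructor <;> linarith [hmono i hs.1, hmono i hs.2, hmono i ht.1, hmono i ht.2]
  calc _ ≤ ∑ i ∈ Finset.range l, Λ * (F^[i] (liftIter F q p x) - F^[i] x) :=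
        (Finset.abs_sum_le_sum_abs _ _).trans (Finset.sum_le_sum h1)
    _ = Λ * ∑ i ∈ Finset.range l, (F^[i] (liftIter F q p x) - F^[i] x) := by rw [Finset.mul_sum]
    _ ≤ Λ * ∑ i ∈ Finset.range Q, (F^[i] (liftIter F q p x) - F^[i] x) := by
        refine mul_le_mul_of_nonneg_left (Finset.sum_le_sum_of_subset_of_nonneg
          (Finset.range_mono hl) fun i _ _ => ?_) hΛ
        exact sub_nonneg.2 (hmono i (hc.lt x).le)
    _ ≤ Λ * 1 := mul_le_mul_of_nonneg_left (hc.sum_le x) hΛ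
    _ = Λ := mul_one Λ

lemma deriv_iterate_le {l : ℕ} (hl : l ≤ Q) {x s t : ℝ}
    (hs : s ∈ Icc x (liftIter F q p x)) (ht : t ∈ Icc x (liftIter F q p x)) :
    deriv F^[l] s ≤ Real.exp Λ * deriv F^[l] t := by
  have h1 := (abs_le.1 (hc.abs_log_deriv_sub_le hF hN hl hs ht)).2
  rw [← Real.exp_log (hF.deriv_iterate_pos l s), ← Real.exp_log (hF.deriv_iterate_pos l t),
    ← Real.exp_add]
  exact Real.exp_le_exp.2 (by linarith)

/-- The derivative of an iterate compares the lengths of an arc and of its image. -/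
lemma deriv_iterate_mul_le {l : ℕ} (hl : l ≤ Q) (x : ℝ) :
    deriv F^[l] x * (liftIter F q p x - x) ≤
      Real.exp Λ * (liftIter F q p (F^[l] x) - F^[l] x) := by
  obtain ⟨ξ, hξ, hξ'⟩ := exists_deriv_eq_slope F^[l] (hc.lt x)
    (hF.contDiff_iterate l).continuous.continuousOn
    ((hF.contDiff_three_iterate l).differentiable (by norm_num)).differentiableOn
  have h0 := sub_pos.2 (hc.lt x)
  have h1 := hc.deriv_iterate_le hF hN hl (left_mem_Icc.2 (hc.lt x).le) (Ioo_subset_Icc_self hξ)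
  rw [eq_div_iff h0.ne'] at hξ'
  rw [liftIter_iterate hF.map_add_one, ← hξ', ← mul_assoc]
  exact mul_le_mul_of_nonneg_right h1 h0.le

omit hN hc in
/-- The multiplier of `g` changes along an orbit as the distortion of the iterate. -/
lemma log_deriv_comp_sub (p : ℤ) (l : ℕ) (x : ℝ) :
    Real.log (deriv F^[q] (F^[l] x)) - Real.log (deriv F^[q] x) =
      Real.log (deriv F^[l] (liftIter F q p x)) - Real.log (deriv F^[l] x) := by
  have hcomm : liftIter F q p ∘ F^[l] = F^[l] ∘ liftIter F q p :=
    funext fun x => liftIter_iterate hF.map_add_one q p l x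
  have h1 := deriv_comp_eq (hF.contDiff_three_liftIter q p) (hF.contDiff_three_iterate l) x
  rw [hcomm, deriv_comp_eq (hF.contDiff_three_iterate l) (hF.contDiff_three_liftIter q p),
    deriv_liftIter] at h1
  have h2 := congrArg Real.log h1
  rw [Real.log_mul (hF.deriv_iterate_pos _ _).ne' (hF.deriv_iterate_pos _ _).ne',
    Real.log_mul (hF.deriv_iterate_pos _ _).ne' (hF.deriv_iterate_pos _ _).ne'] at h2
  linarith

omit hN hc in
lemma deriv_iterate_add_one (x : ℝ) : deriv F^[q] (x + 1) = deriv F^[q] x := by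
  refine deriv_add_one (c := 1) (fun x => ?_) x
  have := iterate_add_int hF.map_add_one q 1 x
  push_cast at this
  exact this

omit hN hc in
/-- The displacement of `g` is minimal somewhere; there `Dg = 1` and the nonlinearity of `g` is
nonnegative. -/
lemma exists_deriv_eq_one : ∃ z, deriv F^[q] z = 1 ∧ 0 ≤ nonlin F^[q] z := by
  obtain ⟨z, hz⟩ := exists_isMinOn_of_periodic (u := fun x => liftIter F q 0 x - x)
    ((hF.contDiff_liftIter q 0).continuous.sub continuous_id)
    (fun x => by rw [liftIter_add_one hF.map_add_one]; ring)
  set u : ℝ → ℝ := fun x => liftIter F q 0 x - x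
  have hmin : IsLocalMin u z := Filter.Eventually.of_forall hz
  have hder : ∀ x, HasDerivAt u (deriv F^[q] x - 1) x := fun x => by
    have := (hasDerivAt_of_contDiff (hF.contDiff_three_liftIter q 0) (by norm_num) x).sub
      (hasDerivAt_id x)
    rwa [deriv_liftIter] at this
  have h1 : deriv F^[q] z = 1 := by linarith [hmin.hasDerivAt_eq_zero (hder z)]
  refine ⟨z, h1, ?_⟩
  by_contra! hneg
  have hder' : deriv u = fun x => deriv F^[q] x - 1 := funext fun x => (hder x).deriv
  have hder2 : deriv (deriv u) z = nonlin F^[q] z := by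
    rw [hder', deriv_sub_const, nonlin, h1, div_one]
  -- otherwise the minimum would be a local maximum too, so that `u` would be locally constant
  have hmax := isLocalMax_of_deriv_deriv_neg (f := u) (x₀ := z) (by rw [hder2]; exact hneg)
    (by simp only [hder', h1, sub_self]) (hder z).continuousAt
  have hconst : u =ᶠ[𝓝 z] fun _ => u z := by
    filter_upwards [hmin, hmax] with y h1 h2 using le_antisymm h2 h1
  have h3 : deriv u =ᶠ[𝓝 z] fun _ => 0 := by
    have := hconst.deriv
    simpa using this
  have h4 := h3.deriv_eq
  rw [hder2, deriv_const] at h4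
  exact hneg.ne h4

/-- The multiplier of `g` is bounded, as it is equal to `1` somewhere and it varies by a bounded
factor along orbits and on the arcs `[x, g x]`. -/
lemma abs_log_deriv_le (x : ℝ) : |Real.log (deriv F^[q] x)| ≤ 3 * Λ := by
  obtain ⟨z, hz, -⟩ := exists_deriv_eq_one (q := q) hF
  have h := hc.abs_sub_le_of_transport (u := fun x => Real.log (deriv F^[q] x)) (a := Λ) (b := Λ)
    (fun x => by rw [deriv_iterate_add_one hF])
    (fun l hl x => by
      rw [log_deriv_comp_sub hF p]
      exact hc.abs_log_deriv_sub_le hF hN hl (right_mem_Icc.2 (hc.lt x).le)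
        (left_mem_Icc.2 (hc.lt x).le))
    (fun x y hy => hc.abs_log_deriv_sub_le hF hN hc.le hy (left_mem_Icc.2 (hc.lt x).le)) x z
  simp only [hz, Real.log_one, sub_zero] at h
  linarith

lemma deriv_le (x : ℝ) : deriv F^[q] x ≤ Real.exp (3 * Λ) := by
  rw [← Real.exp_log (hF.deriv_iterate_pos q x)]
  exact Real.exp_le_exp.2 (abs_le.1 (hc.abs_log_deriv_le hF hN x)).2

lemma one_le_deriv (x : ℝ) : 1 ≤ Real.exp (3 * Λ) * deriv F^[q] x := by
  rw [← Real.exp_log (hF.deriv_iterate_pos q x), ← Real.exp_add]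
  exact Real.one_le_exp (by linarith [(abs_le.1 (hc.abs_log_deriv_le hF hN x)).1])

/-- The lengths of the arcs `[y, g y]` are comparable for `y` in `[x, g x]`. -/
lemma sub_comparable {x y : ℝ} (hy : y ∈ Icc x (liftIter F q p x)) :
    liftIter F q p y - y ≤ Real.exp (3 * Λ) * (liftIter F q p x - x) ∧
      liftIter F q p x - x ≤ Real.exp (3 * Λ) * (liftIter F q p y - y) := by
  have hΛ : 0 ≤ Λ := (abs_nonneg _).trans (hN 0)
  have hK : 1 ≤ Real.exp (3 * Λ) := Real.one_le_exp (by linarith)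
  set K := Real.exp (3 * Λ)
  obtain ⟨d, hd1, hd2, hd⟩ : ∃ d, d ≤ K ∧ 1 ≤ K * d ∧
      liftIter F q p y - liftIter F q p x = d * (y - x) := by
    rcases hy.1.eq_or_lt with h | h
    · refine ⟨1, hK, by linarith, by rw [h]; ring⟩
    · obtain ⟨ξ, hξ, hξ'⟩ := exists_deriv_eq_slope (liftIter F q p) h
        (hF.contDiff_liftIter q p).continuous.continuousOn
        ((hF.contDiff_three_liftIter q p).differentiable (by norm_num)).differentiableOn
      rw [deriv_liftIter, eq_div_iff (sub_pos.2 h).ne'] at hξ'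
      exact ⟨_, hc.deriv_le hF hN ξ, hc.one_le_deriv hF hN ξ, hξ'.symm⟩
  have a1 : 0 ≤ y - x := sub_nonneg.2 hy.1
  have a2 : 0 ≤ liftIter F q p x - y := sub_nonneg.2 hy.2
  constructor
  · nlinarith
  · nlinarith

/-! ### First estimates on the nonlinearity and the Schwarzian derivative -/

/-- The sum `∑ (DF^i)²` is `O(M / β²)`, where `β = g x - x`: one factor `M` is gained since `DF^i` is
comparable with the ratio of the lengths of `F^i [x, g x]` and `[x, g x]`. -/
lemma sum_sq_deriv_mul_le (x : ℝ) :
    (∑ i ∈ Finset.range Q, deriv F^[i] x ^ 2) * (liftIter F q p x - x) ^ 2 ≤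
      Real.exp Λ ^ 2 * M := by
  rw [Finset.sum_mul]
  have h1 : ∀ i ∈ Finset.range Q, deriv F^[i] x ^ 2 * (liftIter F q p x - x) ^ 2 ≤
      Real.exp Λ ^ 2 * M * (F^[i] (liftIter F q p x) - F^[i] x) := by
    intro i hi
    have h2 := hc.deriv_iterate_mul_le hF hN (Finset.mem_range.1 hi).le x
    have h3 := hc.sub_le (F^[i] x)
    have h4 := sub_pos.2 (hc.lt (F^[i] x))
    rw [← liftIter_iterate hF.map_add_one]
    set b := liftIter F q p (F^[i] x) - F^[i] x
    have h5 : 0 ≤ deriv F^[i] x * (liftIter F q p x - x) :=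
      mul_nonneg (hF.deriv_iterate_pos i x).le (sub_pos.2 (hc.lt x)).le
    calc _ = (deriv F^[i] x * (liftIter F q p x - x)) ^ 2 := by ring
      _ ≤ (Real.exp Λ * b) ^ 2 := pow_le_pow_left₀ h5 h2 2
      _ = Real.exp Λ ^ 2 * (b * b) := by ring
      _ ≤ Real.exp Λ ^ 2 * (M * b) := by gcongr
      _ = _ := by ring
  refine (Finset.sum_le_sum h1).trans ?_
  rw [← Finset.mul_sum]
  have := hc.pos
  exact mul_le_of_le_one_right (by positivity) (hc.sum_le x)

lemma abs_schw_mul_le (hS : ∀ x, |schw F x| ≤ Λ) {l : ℕ} (hl : l ≤ Q) (x : ℝ) :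
    |schw F^[l] x| * (liftIter F q p x - x) ^ 2 ≤ Λ * Real.exp Λ ^ 2 * M := by
  have hΛ : 0 ≤ Λ := (abs_nonneg _).trans (hN 0)
  have h1 : |schw F^[l] x| ≤ Λ * ∑ i ∈ Finset.range Q, deriv F^[i] x ^ 2 := by
    rw [hF.schw_iterate, Finset.mul_sum]
    refine (Finset.abs_sum_le_sum_abs _ _).trans ?_
    refine (Finset.sum_le_sum fun i _ => ?_).trans (Finset.sum_le_sum_of_subset_of_nonneg
          (Finset.range_mono hl) fun i _ _ => by positivity)
    rw [abs_mul, abs_of_nonneg (sq_nonneg (deriv F^[i] x))]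
    exact mul_le_mul_of_nonneg_right (hS _) (sq_nonneg _)
  calc _ ≤ Λ * (∑ i ∈ Finset.range Q, deriv F^[i] x ^ 2) * (liftIter F q p x - x) ^ 2 :=
        mul_le_mul_of_nonneg_right h1 (sq_nonneg _)
    _ = Λ * ((∑ i ∈ Finset.range Q, deriv F^[i] x ^ 2) * (liftIter F q p x - x) ^ 2) := by ring
    _ ≤ Λ * (Real.exp Λ ^ 2 * M) :=
        mul_le_mul_of_nonneg_left (hc.sum_sq_deriv_mul_le hF hN x) hΛ
    _ = _ := by ring

lemma abs_nonlin_mul_le {l : ℕ} (hl : l ≤ Q) (x : ℝ) :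
    |nonlin F^[l] x| * (liftIter F q p x - x) ≤ Λ * Real.exp Λ := by
  have hΛ : 0 ≤ Λ := (abs_nonneg _).trans (hN 0)
  have hb := (sub_pos.2 (hc.lt x)).le
  have h1 : |nonlin F^[l] x| ≤ Λ * ∑ i ∈ Finset.range Q, deriv F^[i] x := by
    rw [hF.nonlin_iterate, Finset.mul_sum]
    refine (Finset.abs_sum_le_sum_abs _ _).trans ?_
    refine (Finset.sum_le_sum fun i _ => ?_).trans (Finset.sum_le_sum_of_subset_of_nonneg
          (Finset.range_mono hl) fun i _ _ => mul_nonneg hΛ (hF.deriv_iterate_pos i x).le)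
    rw [abs_mul, abs_of_pos (hF.deriv_iterate_pos i x)]
    exact mul_le_mul_of_nonneg_right (hN _) (hF.deriv_iterate_pos i x).le
  have h2 : (∑ i ∈ Finset.range Q, deriv F^[i] x) * (liftIter F q p x - x) ≤ Real.exp Λ := by
    rw [Finset.sum_mul]
    have h3 : ∀ i ∈ Finset.range Q, deriv F^[i] x * (liftIter F q p x - x) ≤
        Real.exp Λ * (F^[i] (liftIter F q p x) - F^[i] x) := fun i hi => by
      rw [← liftIter_iterate hF.map_add_one]
      exact hc.deriv_iterate_mul_le hF hN (Finset.mem_range.1 hi).le x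
    refine (Finset.sum_le_sum h3).trans ?_
    rw [← Finset.mul_sum]
    exact mul_le_of_le_one_right (Real.exp_pos _).le (hc.sum_le x)
  calc _ ≤ Λ * (∑ i ∈ Finset.range Q, deriv F^[i] x) * (liftIter F q p x - x) :=
        mul_le_mul_of_nonneg_right h1 hb
    _ = Λ * ((∑ i ∈ Finset.range Q, deriv F^[i] x) * (liftIter F q p x - x)) := by ring
    _ ≤ Λ * Real.exp Λ := mul_le_mul_of_nonneg_left h2 hΛ

end

end IsCell

lemma abs_exp_sub_one_le_mul_exp (t : ℝ) : |Real.exp t - 1| ≤ |t| * Real.exp |t| := by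
  have h1 := Real.add_one_le_exp t
  have h2 := Real.add_one_le_exp (-t)
  have h3 : Real.exp t * Real.exp (-t) = 1 := by rw [← Real.exp_add]; simp
  have h4 := Real.exp_pos t
  have h5 : 1 ≤ Real.exp |t| := Real.one_le_exp (abs_nonneg t)
  rcases le_total 0 t with ht | ht
  · rw [abs_of_nonneg ht, abs_of_nonneg (by linarith)]
    nlinarith
  · have h6 : Real.exp t ≤ 1 := Real.exp_le_one_iff.2 ht
    rw [abs_of_nonpos (by linarith)]
    have := abs_nonneg t
    rw [abs_of_nonpos ht] at *
    nlinarith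

/-- `2 cosh (L / 2) ≥ 2 + L² / 4`. -/
lemma sq_div_four_le (L : ℝ) : L ^ 2 / 4 ≤ (1 + Real.exp L) * Real.exp (-L / 2) - 2 := by
  have h1 : (1 + Real.exp L) * Real.exp (-L / 2) - 2 = (2 * Real.sinh (L / 4)) ^ 2 := by
    have e1 : Real.exp L = Real.exp (L / 4) ^ 4 := by
      rw [← Real.exp_nat_mul]; congr 1; push_cast; ring
    have e2 : Real.exp (-L / 2) = Real.exp (-(L / 4)) ^ 2 := by
      rw [← Real.exp_nat_mul]; congr 1; push_cast; ring
    have e3 : Real.exp (L / 4) * Real.exp (-(L / 4)) = 1 := by rw [← Real.exp_add]; simp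
    rw [Real.sinh_eq, e1, e2]
    generalize Real.exp (L / 4) = a at *
    generalize Real.exp (-(L / 4)) = b at *
    have : a ^ 4 * b ^ 2 = a ^ 2 * (a * b) ^ 2 := by ring
    rw [add_mul, this, e3]
    linear_combination (2 : ℝ) * e3
  have h2 : |L / 4| ≤ |Real.sinh (L / 4)| := by
    rcases le_total 0 (L / 4) with h | h
    · rw [abs_of_nonneg h]
      exact (Real.self_le_sinh_iff.2 h).trans (le_abs_self _)
    · rw [abs_of_nonpos h]
      have := Real.sinh_le_self_iff.2 h
      exact (neg_le_neg this).trans (neg_le_abs _)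
  have h3 := sq_le_sq.2 h2
  rw [h1]
  nlinarith

namespace IsCell

section
variable {k : ℕ} {F : ℝ → ℝ} {q Q : ℕ} {p P : ℤ} {M : ℝ} (hc : IsCell F q Q p P M)
  (hF : IsSmoothLift k F) {Λ : ℝ} (hN : ∀ x, |nonlin F x| ≤ Λ) (hS : ∀ x, |schw F x| ≤ Λ)
include hc hF hN hS

lemma abs_schw_le {l : ℕ} (hl : l ≤ Q) {x t : ℝ} (ht : t ∈ Icc x (liftIter F q p x)) :
    |schw F^[l] t| ≤
      Λ * Real.exp Λ ^ 2 * Real.exp (3 * Λ) ^ 2 * M / (liftIter F q p x - x) ^ 2 := by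
  have h1 := hc.abs_schw_mul_le hF hN hS hl t
  have h2 := (hc.sub_comparable hF hN ht).2
  have hb := sub_pos.2 (hc.lt x)
  rw [le_div_iff₀ (by positivity)]
  calc _ ≤ |schw F^[l] t| * (Real.exp (3 * Λ) * (liftIter F q p t - t)) ^ 2 := by gcongr
    _ = Real.exp (3 * Λ) ^ 2 * (|schw F^[l] t| * (liftIter F q p t - t) ^ 2) := by ring
    _ ≤ Real.exp (3 * Λ) ^ 2 * (Λ * Real.exp Λ ^ 2 * M) := by gcongr
    _ = _ := by ring

/-- The iterates of order at most `Q` are close to Möbius maps on the arcs `[x, g x]`. -/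
lemma moebius_approx_iterate {l : ℕ} (hl : l ≤ Q) (x : ℝ) :
    let ε := Λ * Real.exp Λ ^ 4 * Real.exp (3 * Λ) ^ 2 * M
    let y := invSqrtDeriv F^[l]
    let g := liftIter F q p
    |y (g x) / y x - 1 + nonlin F^[l] x * (g x - x) / 2| ≤ ε ∧
    |y x / y (g x) - 1 - nonlin F^[l] (g x) * (g x - x) / 2| ≤ ε ∧
    |(F^[l] (g x) - F^[l] x) / (g x - x) * (y x * y (g x)) - 1| ≤ ε := by
  intro ε y g
  have hΛ : 0 ≤ Λ := (abs_nonneg _).trans (hN 0)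
  have hb := sub_pos.2 (hc.lt x)
  have hD2 : Real.exp (Λ / 2) ^ 2 = Real.exp Λ := by
    rw [← Real.exp_nat_mul]; congr 1; push_cast; ring
  have h := moebius_approx (D := Real.exp (Λ / 2)) (hF.contDiff_three_iterate l)
    (hF.deriv_iterate_pos l) (hc.lt x)
    (fun s hs t ht => by rw [hD2]; exact hc.deriv_iterate_le hF hN hl hs ht)
    (Real.one_le_exp (by linarith)) (fun t ht => hc.abs_schw_le hF hN hS hl ht)
  have e : Real.exp (Λ / 2) ^ 4 * (Λ * Real.exp Λ ^ 2 * Real.exp (3 * Λ) ^ 2 * M /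
      (liftIter F q p x - x) ^ 2) * (liftIter F q p x - x) ^ 2 = ε := by
    rw [show Real.exp (Λ / 2) ^ 4 = (Real.exp (Λ / 2) ^ 2) ^ 2 by ring, hD2]
    simp only [ε]
    field_simp
  rw [e] at h
  exact h

end

end IsCell

lemma invSqrtDeriv_liftIter (F : ℝ → ℝ) (q : ℕ) (p : ℤ) :
    invSqrtDeriv (liftIter F q p) = invSqrtDeriv F^[q] := by
  funext x
  rw [invSqrtDeriv, invSqrtDeriv, deriv_liftIter]

namespace IsSmoothLift

variable {k : ℕ} {F : ℝ → ℝ} (hF : IsSmoothLift k F)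
include hF

/-! ### The multiplier of the return map -/

/-- The trace of `g` is constant up to `O(M)` on the whole circle. -/
lemma exists_abs_moebTrace_sub_le : ∃ C, 0 ≤ C ∧ ∀ {q Q : ℕ} {p P : ℤ} {M : ℝ},
    IsCell F q Q p P M → ∀ x z,
      |moebTrace (liftIter F q p) x - moebTrace (liftIter F q p) z| ≤ C * M := by
  obtain ⟨Λ, hΛ, hN, hS⟩ := hF.exists_bound_nonlin_schw
  set E := Real.exp Λ with hE
  set K := Real.exp (3 * Λ) with hK
  have hE0 : 0 < E := Real.exp_pos _
  have hK1 : 1 ≤ K := Real.one_le_exp (by linarith)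
  have hK0 : 0 < K := Real.exp_pos _
  refine ⟨2 * ((Λ * E ^ 4 * K ^ 2) * K * (1 + K + Λ * E + Λ * E * K * K + Λ * E)) +
    Λ * E ^ 2 * K ^ 2 * K, by positivity, ?_⟩
  intro q Q p P M hc x z
  have hM := hc.pos
  set g := liftIter F q p with hg
  have hgd : ∀ x, deriv g x = deriv F^[q] x := fun x => by rw [hg, deriv_liftIter]
  have hgpos : ∀ x, 0 < deriv g x := fun x => by rw [hgd]; exact hF.deriv_iterate_pos q x
  have hy : ∀ x, invSqrtDeriv g x ≤ K := by
    intro x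
    rw [invSqrtDeriv, hgd, hK]
    refine Real.exp_le_exp.2 ?_
    have := (abs_le.1 (hc.abs_log_deriv_le hF hN x))
    linarith [this.1]
  have key := hc.abs_sub_le_of_transport (u := moebTrace g)
    (a := (Λ * E ^ 4 * K ^ 2) * K * (1 + K + Λ * E + Λ * E * K * K + Λ * E) * M)
    (b := Λ * E ^ 2 * K ^ 2 * K * M) ?_ ?_ ?_ x z
  · refine key.trans (le_of_eq ?_)
    ring
  · intro x
    have h1 : ∀ x, g (x + 1) = g x + 1 := liftIter_add_one hF.map_add_one q p
    have h2 := deriv_add_one h1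
    have h3 := deriv_add_one (c := 0) (u := deriv g) (fun x => by rw [h2, add_zero])
    rw [moebTrace, moebTrace, invSqrtDeriv, invSqrtDeriv, nonlin, nonlin, h2, h3, h1]
    ring
  · intro l hl x
    obtain ⟨h1, h2, h3⟩ := hc.moebius_approx_iterate hF hN hS hl x
    have hcomm : g ∘ F^[l] = F^[l] ∘ g :=
      funext fun x => liftIter_iterate hF.map_add_one q p l x
    have h4 := abs_moebTrace_comp_sub_le (hF.contDiff_three_liftIter q p) hgpos
      (hF.contDiff_three_iterate l) (hF.deriv_iterate_pos l) hcomm (hc.lt x) h1 h2 h3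
    have hb := sub_pos.2 (hc.lt x)
    have b1 : |nonlin g x * (g x - x) / 2| ≤ Λ * E := by
      rw [abs_div, abs_mul, abs_of_pos hb, abs_two]
      have := hc.abs_nonlin_mul_le hF hN hc.le x
      rw [hg, nonlin_liftIter]
      have h0 : 0 ≤ |nonlin F^[q] x| * (liftIter F q p x - x) := mul_nonneg (abs_nonneg _) hb.le
      linarith
    have b2 : |nonlin F^[l] x * (g x - x) / 2| ≤ Λ * E := by
      rw [abs_div, abs_mul, abs_of_pos hb, abs_two]
      have := hc.abs_nonlin_mul_le hF hN hl x
      have h0 : 0 ≤ |nonlin F^[l] x| * (liftIter F q p x - x) := mul_nonneg (abs_nonneg _) hb.le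
      linarith
    have b3 : |nonlin F^[l] (g x) * (g x - x) / 2| ≤ Λ * E * K := by
      rw [abs_div, abs_mul, abs_of_pos hb, abs_two]
      have h5 := hc.abs_nonlin_mul_le hF hN hl (g x)
      have h6 := (hc.sub_comparable hF hN (right_mem_Icc.2 (hc.lt x).le)).2
      have h0 : 0 ≤ |nonlin F^[l] (g x)| * (liftIter F q p x - x) :=
        mul_nonneg (abs_nonneg _) hb.le
      have h7 : |nonlin F^[l] (g x)| * (liftIter F q p x - x) ≤ Λ * E * K := by
        calc _ ≤ |nonlin F^[l] (g x)| * (K * (liftIter F q p (g x) - g x)) := by gcongr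
          _ = (|nonlin F^[l] (g x)| * (liftIter F q p (g x) - g x)) * K := by ring
          _ ≤ _ := by gcongr
      linarith
    refine h4.trans ?_
    have b4 : deriv g x ≤ K := by rw [hgd]; exact hc.deriv_le hF hN x
    have b5 := hy x
    have b6 := (invSqrtDeriv_pos g x).le
    have b7 := (hgpos x).le
    calc _ ≤ (Λ * E ^ 4 * K ^ 2 * M) * K * (1 + K + Λ * E + Λ * E * K * K + Λ * E) := by gcongr
      _ = _ := by ring
  · intro x y hyx
    have hb := sub_pos.2 (hc.lt x)
    have h1 := (convex_Icc x (g x)).norm_image_sub_le_of_norm_hasDerivWithin_le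
      (f := moebTrace g) (C := Λ * E ^ 2 * K ^ 2 * K * M / (g x - x))
      (fun t _ => (hasDerivAt_moebTrace (hF.contDiff_three_liftIter q p) hgpos t).hasDerivWithinAt)
      (fun t ht => ?_) (left_mem_Icc.2 (hc.lt x).le) hyx
    · refine h1.trans ?_
      have h2 : ‖y - x‖ ≤ g x - x := by
        rw [Real.norm_eq_abs, abs_of_nonneg (sub_nonneg.2 hyx.1)]
        linarith [hyx.2]
      calc _ ≤ Λ * E ^ 2 * K ^ 2 * K * M / (g x - x) * (g x - x) :=
            mul_le_mul_of_nonneg_left h2 (by positivity)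
        _ = _ := div_mul_cancel₀ _ hb.ne'
    · have hbt := sub_pos.2 (hc.lt t)
      have c1 := hc.abs_schw_mul_le hF hN hS hc.le t
      have c2 := (hc.sub_comparable hF hN ht).2
      rw [Real.norm_eq_abs, abs_mul, abs_neg, abs_div, abs_mul, abs_of_pos hbt, abs_two,
        abs_of_pos (invSqrtDeriv_pos g t), le_div_iff₀ hb, hg, schw_liftIter, ← hg]
      have c3 := hy t
      have c4 := (invSqrtDeriv_pos g t).le
      calc _ ≤ (g t - t) * |schw F^[q] t| / 2 * K * (K * (g t - t)) := by gcongr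
        _ = (|schw F^[q] t| * (g t - t) ^ 2) * (K * K / 2) := by ring
        _ ≤ (Λ * E ^ 2 * M) * (K * K / 2) := by gcongr
        _ ≤ (Λ * E ^ 2 * M) * (K * K * K) := by
            gcongr
            nlinarith [mul_pos hK0 hK0]
        _ = _ := by ring

/-- The multiplier of `g` is `1 + O(√M)`. -/
lemma exists_abs_log_deriv_le : ∃ C, 0 ≤ C ∧ ∀ {q Q : ℕ} {p P : ℤ} {M : ℝ},
    IsCell F q Q p P M → ∀ x, |Real.log (deriv F^[q] x)| ≤ C * √M := by
  obtain ⟨C, hC, hT⟩ := hF.exists_abs_moebTrace_sub_le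
  refine ⟨√(4 * C), Real.sqrt_nonneg _, ?_⟩
  intro q Q p P M hc x
  obtain ⟨z, hz, hz'⟩ := IsCell.exists_deriv_eq_one (q := q) hF
  have hb := sub_pos.2 (hc.lt z)
  have hTz : moebTrace (liftIter F q p) z ≤ 2 := by
    rw [moebTrace, invSqrtDeriv_liftIter, invSqrtDeriv, nonlin_liftIter, deriv_liftIter, hz]
    simp only [Real.log_one, neg_zero, zero_div, Real.exp_zero, mul_one]
    nlinarith [mul_nonneg hb.le hz']
  -- a point where `|log Dg|` is maximal
  set u : ℝ → ℝ := fun x => Real.log (deriv F^[q] x) with hu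
  have hder : ∀ x, HasDerivAt u (nonlin F^[q] x) x :=
    hasDerivAt_log_deriv (hF.contDiff_three_iterate q) (hF.deriv_iterate_pos q)
  have hcont : Continuous u := continuous_iff_continuousAt.2 fun x => (hder x).continuousAt
  obtain ⟨w, hw⟩ := exists_isMinOn_of_periodic (u := fun x => -(u x) ^ 2) (hcont.pow 2).neg
    (fun x => by simp only [hu, IsCell.deriv_iterate_add_one hF])
  have hcrit : u w * nonlin F^[q] w = 0 := by
    have h1 : HasDerivAt (fun x => -(u x) ^ 2) (-(2 * u w * nonlin F^[q] w)) w := by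
      exact ((hder w).pow 2).neg.congr_deriv (by simp)
    have h2 : IsLocalMin (fun x => -(u x) ^ 2) w := Filter.Eventually.of_forall hw
    have := h2.hasDerivAt_eq_zero h1
    linarith
  have hwx : (u x) ^ 2 ≤ (u w) ^ 2 := by
    have := hw x
    simp only [neg_le_neg_iff] at this
    exact this
  have hM := hc.pos
  have huw : (u w) ^ 2 ≤ 4 * C * M := by
    rcases mul_eq_zero.1 hcrit with h | h
    · rw [h, zero_pow two_ne_zero]; positivity
    · have h1 := hT hc w z
      have h2 := (abs_le.1 h1).2
      have h3 : moebTrace (liftIter F q p) w = (1 + Real.exp (u w)) * Real.exp (-u w / 2) := by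
        rw [moebTrace, invSqrtDeriv_liftIter, invSqrtDeriv, nonlin_liftIter, deriv_liftIter, h,
          hu, Real.exp_log (hF.deriv_iterate_pos q w)]
        ring
      have h4 := sq_div_four_le (u w)
      linarith
  have h5 : |u x| ≤ √(4 * C * M) := Real.abs_le_sqrt (hwx.trans huw)
  rwa [Real.sqrt_mul (by positivity : 0 ≤ 4 * C)] at h5

/-- The nonlinearity of an iterate of order at most `Q` is `O(√M / |g x - x|)`. -/
lemma exists_abs_nonlin_iterate_le : ∃ C, 0 ≤ C ∧ ∀ {q Q : ℕ} {p P : ℤ} {M : ℝ},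
    IsCell F q Q p P M → ∀ l ≤ Q, ∀ x,
      |nonlin F^[l] x| * (liftIter F q p x - x) ≤ C * √M := by
  obtain ⟨Λ, hΛ, hN, hS⟩ := hF.exists_bound_nonlin_schw
  obtain ⟨C, hC, hL⟩ := hF.exists_abs_log_deriv_le
  refine ⟨2 * (Λ * Real.exp Λ ^ 4 * Real.exp (3 * Λ) ^ 2) + 2 * (C * Real.exp C),
    by positivity, ?_⟩
  intro q Q p P M hc l hl x
  have hM := hc.pos
  have hb := sub_pos.2 (hc.lt x)
  have hs1 : √M ≤ 1 := Real.sqrt_le_one.2 hc.le_one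
  have hs0 : 0 ≤ √M := Real.sqrt_nonneg M
  have hMs : M ≤ √M := by
    nlinarith [Real.mul_self_sqrt hM.le]
  have h1 := (hc.moebius_approx_iterate hF hN hS hl x).1
  set ε := Λ * Real.exp Λ ^ 4 * Real.exp (3 * Λ) ^ 2 with hε
  set τ := Real.log (deriv F^[q] (F^[l] x)) - Real.log (deriv F^[q] x) with hτ
  have h2 : invSqrtDeriv F^[l] (liftIter F q p x) / invSqrtDeriv F^[l] x =
      Real.exp (-τ / 2) := by
    rw [hτ, IsCell.log_deriv_comp_sub hF p, invSqrtDeriv, invSqrtDeriv, ← Real.exp_sub]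
    congr 1
    ring
  have h3 : |-τ / 2| ≤ C * √M := by
    have a1 := abs_le.1 (hL hc (F^[l] x))
    have a2 := abs_le.1 (hL hc x)
    rw [abs_le]
    constructor <;> linarith [a1.1, a1.2, a2.1, a2.2]
  have h4 : |Real.exp (-τ / 2) - 1| ≤ C * Real.exp C * √M := by
    refine (abs_exp_sub_one_le_mul_exp _).trans ?_
    have h5 : |-τ / 2| ≤ C := h3.trans (mul_le_of_le_one_right hC hs1)
    calc _ ≤ (C * √M) * Real.exp C := by gcongr
      _ = _ := by ring
  rw [h2] at h1
  have h6 : |nonlin F^[l] x * (liftIter F q p x - x) / 2| ≤ ε * M + C * Real.exp C * √M := by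
    have := abs_sub (Real.exp (-τ / 2) - 1 + nonlin F^[l] x * (liftIter F q p x - x) / 2)
      (Real.exp (-τ / 2) - 1)
    rw [add_sub_cancel_left] at this
    linarith
  rw [abs_div, abs_mul, abs_of_pos hb, abs_two] at h6
  have : ε * M ≤ ε * √M := mul_le_mul_of_nonneg_left hMs (by positivity)
  linarith

end IsSmoothLift

/-! ### Higher derivatives of the iterates -/

lemma JetBound.const_mul {u : ℝ → ℝ} {x A B : ℝ} {s : ℕ} (hu : JetBound u x s A B) {c : ℝ}
    (hc : 0 ≤ c) : JetBound (fun y => c * u y) x s (c * A) B := by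
  intro j hj
  rw [iteratedDeriv_const_mul_field, abs_mul, abs_of_nonneg hc, mul_assoc]
  exact mul_le_mul_of_nonneg_left (hu j hj) hc

namespace IsSmoothLift

variable {k : ℕ} {F : ℝ → ℝ} (hF : IsSmoothLift k F)
include hF

/-- The derivatives of order `j` of the nonlinearities of the iterates of order at most `Q` are
`O((√M / |g x - x|)^(j + 1))`, by induction from `D N = S + N² / 2`. -/
lemma exists_jetBound_nonlin_iterate (s : ℕ) (hs : s + 2 ≤ k) : ∃ C, 0 ≤ C ∧
    ∀ {q Q : ℕ} {p P : ℤ} {M : ℝ}, IsCell F q Q p P M → ∀ l ≤ Q, ∀ x,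
      JetBound (nonlin F^[l]) x s (C * (√M / (liftIter F q p x - x)))
        (√M / (liftIter F q p x - x)) := by
  obtain ⟨C₀, hC₀, h0⟩ := hF.exists_abs_nonlin_iterate_le
  have h0' : ∀ {q Q : ℕ} {p P : ℤ} {M : ℝ}, IsCell F q Q p P M → ∀ l ≤ Q, ∀ x,
      |nonlin F^[l] x| ≤ C₀ * (√M / (liftIter F q p x - x)) := by
    intro q Q p P M hc l hl x
    rw [← mul_div_assoc, le_div_iff₀ (sub_pos.2 (hc.lt x))]
    exact h0 hc l hl x
  induction s with
  | zero =>
    refine ⟨C₀, hC₀, ?_⟩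
    intro q Q p P M hc l hl x j hj
    obtain rfl : j = 0 := by omega
    simpa using h0' hc l hl x
  | succ s ih =>
    obtain ⟨C, hC, ih⟩ := ih (by omega)
    obtain ⟨Λ, hΛ, hN, hS⟩ := hF.exists_bound_nonlin_schw
    obtain ⟨A, hA, hA'⟩ := hF.exists_bound_iteratedDeriv_schw s (by omega)
    obtain ⟨C₁, hC₁, h1⟩ := exists_jetBound_deriv s C
    obtain ⟨C₂, hC₂, h2⟩ := exists_jetBound_comp s (C₁ * Real.exp Λ) hA
    refine ⟨max C₀ (2 ^ s * C₂ * (2 ^ s * C₁ * C₁) * Real.exp Λ ^ 2 + 1 / 2 * (2 ^ s * C * C)),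
      hC₀.trans (le_max_left _ _), ?_⟩
    intro q Q p P M hc l hl x
    have hb := sub_pos.2 (hc.lt x)
    have hM := hc.pos
    set B := √M / (liftIter F q p x - x) with hBdef
    have hB : 0 ≤ B := div_nonneg (Real.sqrt_nonneg _) hb.le
    have hB2 : M / (liftIter F q p x - x) ^ 2 = B ^ 2 := by
      rw [hBdef, div_pow, Real.sq_sqrt hM.le]
    have hpos := hF.deriv_iterate_pos
    have cN : ∀ i, ContDiff ℝ s (nonlin F^[i]) := fun i =>
      contDiff_nonlin (hF.contDiff_iterate i) (hpos i) (by omega)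
    have cD : ∀ i, ContDiff ℝ s (deriv F^[i]) := fun i =>
      contDiff_deriv_of_succ (hF.contDiff_iterate i) (by omega)
    have cS : ContDiff ℝ s (schw F) := contDiff_schw hF.contDiff hF.deriv_pos (by omega)
    have cI : ∀ i, ContDiff ℝ s F^[i] := fun i =>
      (hF.contDiff_iterate i).of_le (by exact_mod_cast (by omega : s ≤ k))
    have cSi : ∀ i, ContDiff ℝ s (fun y => schw F (F^[i] y)) := fun i => cS.comp (cI i)
    refine JetBound.succ ((h0' hc l hl x).trans (by gcongr; exact le_max_left _ _)) ?_
    have e : deriv (nonlin F^[l]) = fun y =>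
        (∑ i ∈ Finset.range l, schw F (F^[i] y) * (deriv F^[i] y * deriv F^[i] y)) +
          1 / 2 * (nonlin F^[l] y * nonlin F^[l] y) := by
      funext y
      rw [(hasDerivAt_nonlin (hF.contDiff_three_iterate l) (hpos l) y).deriv, hF.schw_iterate]
      congr 1
      · exact Finset.sum_congr rfl fun i _ => by ring
      · ring
    have jD : ∀ i ∈ Finset.range l, JetBound (deriv F^[i]) x s (C₁ * deriv F^[i] x) B := by
      intro i hi
      have hiQ : i ≤ Q := (Finset.mem_range.1 hi).le.trans hl
      exact (h1 F^[i] k x B (hF.contDiff_iterate i) (hpos i) (by omega) hF.three_le hB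
        (ih hc i hiQ x)).mono_order (Nat.le_succ s)
    have jS : ∀ i ∈ Finset.range l, JetBound (fun y => schw F (F^[i] y)) x s C₂ B := by
      intro i hi
      have hiQ : i ≤ Q := (Finset.mem_range.1 hi).le.trans hl
      refine h2 (schw F) F^[i] x B cS
        ((hF.contDiff_iterate i).of_le (by exact_mod_cast (by omega : s + 1 ≤ k))) hB hA'
        ((jD i hi).mono_const ?_ hB)
      have h3 := hc.deriv_iterate_mul_le hF hN hiQ x
      have h4 := hc.sub_le (F^[i] x)
      have h5 : M ≤ √M := by
        have h6 : √M ≤ 1 := Real.sqrt_le_one.2 hc.le_one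
        nlinarith [Real.mul_self_sqrt hM.le, Real.sqrt_nonneg M]
      have h6 : deriv F^[i] x ≤ Real.exp Λ * B := by
        rw [hBdef, ← mul_div_assoc, le_div_iff₀ hb]
        exact h3.trans (mul_le_mul_of_nonneg_left (h4.trans h5) (Real.exp_pos _).le)
      calc _ ≤ C₁ * (Real.exp Λ * B) := mul_le_mul_of_nonneg_left h6 hC₁
        _ = _ := by ring
    have jsum := JetBound.sum (fun i hi => (jS i hi).mul ((jD i hi).mul (jD i hi) hB (cD i) (cD i))
      hB (cSi i) ((cD i).mul (cD i))) (fun i _ => (cSi i).mul ((cD i).mul (cD i)))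
    have jN := ((ih hc l hl x).mul (ih hc l hl x) hB (cN l) (cN l)).const_mul
      (c := 1 / 2) (by norm_num)
    rw [e]
    refine (jsum.add jN (ContDiff.sum fun i _ => (cSi i).mul ((cD i).mul (cD i)))
      (contDiff_const.mul ((cN l).mul (cN l)))).mono_const ?_ hB
    have hsum : ∑ i ∈ Finset.range l, deriv F^[i] x ^ 2 ≤ Real.exp Λ ^ 2 * B ^ 2 := by
      rw [← hB2, ← mul_div_assoc, le_div_iff₀ (by positivity)]
      refine le_trans ?_ (hc.sum_sq_deriv_mul_le hF hN x)
      exact mul_le_mul_of_nonneg_right (Finset.sum_le_sum_of_subset_of_nonneg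
        (Finset.range_mono hl) fun i _ _ => by positivity) (by positivity)
    have e2 : ∑ i ∈ Finset.range l,
        2 ^ s * C₂ * (2 ^ s * (C₁ * deriv F^[i] x) * (C₁ * deriv F^[i] x)) =
        2 ^ s * C₂ * (2 ^ s * C₁ * C₁) * ∑ i ∈ Finset.range l, deriv F^[i] x ^ 2 := by
      rw [Finset.mul_sum]
      exact Finset.sum_congr rfl fun i _ => by ring
    rw [e2]
    calc _ ≤ 2 ^ s * C₂ * (2 ^ s * C₁ * C₁) * (Real.exp Λ ^ 2 * B ^ 2) +
          1 / 2 * (2 ^ s * (C * B) * (C * B)) := by gcongr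
      _ = (2 ^ s * C₂ * (2 ^ s * C₁ * C₁) * Real.exp Λ ^ 2 + 1 / 2 * (2 ^ s * C * C)) * B * B := by
          ring
      _ ≤ _ := by gcongr; exact le_max_right _ _

end IsSmoothLift

namespace IsCell

section
variable {k : ℕ} {F : ℝ → ℝ} {q Q : ℕ} {p P : ℤ} {M : ℝ} (hc : IsCell F q Q p P M)
  (hF : IsSmoothLift k F) {Λ : ℝ} (hN : ∀ x, |nonlin F x| ≤ Λ)
include hc hF hN

/-- The derivative of `e` is bounded: its logarithm varies by at most `Λ` along orbits, because `x`
belongs to the arc `[e x, g (e x)]`, and it vanishes somewhere. -/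
lemma deriv_iterate_le_exp (x : ℝ) : deriv F^[Q] x ≤ Real.exp (3 * Λ) := by
  obtain ⟨z, hz, -⟩ := exists_deriv_eq_one (q := Q) hF
  have h := hc.abs_sub_le_of_transport (u := fun x => Real.log (deriv F^[Q] x)) (a := Λ) (b := Λ)
    (fun x => by rw [deriv_iterate_add_one hF])
    (fun l hl x => by
      rw [log_deriv_comp_sub hF P]
      exact hc.abs_log_deriv_sub_le hF hN hl (x := liftIter F Q P x)
        (left_mem_Icc.2 (hc.lt _).le) ⟨(hc.lt_self x).le, (hc.self_lt x).le⟩)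
    (fun x y hy => hc.abs_log_deriv_sub_le hF hN le_rfl hy (left_mem_Icc.2 (hc.lt x).le)) x z
  simp only [hz, Real.log_one, sub_zero] at h
  rw [← Real.exp_log (hF.deriv_iterate_pos Q x)]
  exact Real.exp_le_exp.2 (by linarith [(abs_le.1 h).2])

/-- The displacement of `g` is comparable with its value at `x` on `[x, g^m x]`. -/
lemma le_pow_mul_sub (m : ℕ) : ∀ x, ∀ t ∈ Icc x ((liftIter F q p)^[m] x),
    liftIter F q p x - x ≤ Real.exp (3 * Λ) ^ m * (liftIter F q p t - t) := by
  have hΛ : 0 ≤ Λ := (abs_nonneg _).trans (hN 0)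
  have hK : 1 ≤ Real.exp (3 * Λ) := Real.one_le_exp (by linarith)
  induction m with
  | zero =>
    intro x t ht
    obtain rfl : t = x := le_antisymm ht.2 ht.1
    simp
  | succ m ih =>
    intro x t ht
    rw [Function.iterate_succ_apply] at ht
    have hbt := sub_pos.2 (hc.lt t)
    rcases le_total t (liftIter F q p x) with h | h
    · refine (hc.sub_comparable hF hN ⟨ht.1, h⟩).2.trans ?_
      exact mul_le_mul_of_nonneg_right (le_self_pow₀ hK (Nat.succ_ne_zero m)) hbt.le
    · have h1 := ih (liftIter F q p x) t ⟨h, ht.2⟩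
      have h2 := (hc.sub_comparable hF hN (right_mem_Icc.2 (hc.lt x).le)).2
      calc _ ≤ _ := h2
        _ ≤ Real.exp (3 * Λ) * (Real.exp (3 * Λ) ^ m * (liftIter F q p t - t)) := by gcongr
        _ = _ := by ring

lemma sub_iterate_le_pow (m : ℕ) (x : ℝ) :
    liftIter F q p ((liftIter F q p)^[m] x) - (liftIter F q p)^[m] x ≤
      Real.exp (3 * Λ) ^ m * (liftIter F q p x - x) := by
  induction m with
  | zero => simp
  | succ m ih =>
    rw [Function.iterate_succ_apply']
    have h2 := (hc.sub_comparable hF hN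
      (right_mem_Icc.2 (hc.lt ((liftIter F q p)^[m] x)).le)).1
    calc _ ≤ _ := h2
      _ ≤ Real.exp (3 * Λ) * (Real.exp (3 * Λ) ^ m * (liftIter F q p x - x)) := by gcongr
      _ = _ := by ring

end

end IsCell

/-! ### Displacements of two consecutive return maps -/

namespace IsSmoothLift

variable {k : ℕ} {F : ℝ → ℝ} (hF : IsSmoothLift k F)
include hF

/-- On an arc `[x, g x]` the distortion of the iterates of order at most `Q` is `O(√M)`. -/
lemma exists_abs_log_deriv_sub_le : ∃ C, 0 ≤ C ∧ ∀ {q Q : ℕ} {p P : ℤ} {M : ℝ},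
    IsCell F q Q p P M → ∀ l ≤ Q, ∀ x, ∀ s ∈ Icc x (liftIter F q p x),
      ∀ t ∈ Icc x (liftIter F q p x),
        |Real.log (deriv F^[l] s) - Real.log (deriv F^[l] t)| ≤ C * √M := by
  obtain ⟨C, hC, h⟩ := hF.exists_abs_nonlin_iterate_le
  obtain ⟨Λ, hΛ, hN, hS⟩ := hF.exists_bound_nonlin_schw
  refine ⟨C * Real.exp (3 * Λ), by positivity, ?_⟩
  intro q Q p P M hc l hl x s hs t ht
  have hb := sub_pos.2 (hc.lt x)
  have h1 := (convex_Icc x (liftIter F q p x)).norm_image_sub_le_of_norm_hasDerivWithin_le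
    (f := fun y => Real.log (deriv F^[l] y))
    (C := C * Real.exp (3 * Λ) * √M / (liftIter F q p x - x))
    (fun y _ => (hasDerivAt_log_deriv (hF.contDiff_three_iterate l)
      (hF.deriv_iterate_pos l) y).hasDerivWithinAt)
    (fun y hy => ?_) ht hs
  · refine h1.trans ?_
    have h2 : ‖s - t‖ ≤ liftIter F q p x - x := by
      rw [Real.norm_eq_abs, abs_le]
      constructor <;> linarith [hs.1, hs.2, ht.1, ht.2]
    calc _ ≤ C * Real.exp (3 * Λ) * √M / (liftIter F q p x - x) * (liftIter F q p x - x) := by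
          gcongr
      _ = _ := div_mul_cancel₀ _ hb.ne'
  · rw [Real.norm_eq_abs, le_div_iff₀ hb]
    calc _ ≤ |nonlin F^[l] y| * (Real.exp (3 * Λ) * (liftIter F q p y - y)) :=
          mul_le_mul_of_nonneg_left (hc.sub_comparable hF hN hy).2 (abs_nonneg _)
      _ = Real.exp (3 * Λ) * (|nonlin F^[l] y| * (liftIter F q p y - y)) := by ring
      _ ≤ Real.exp (3 * Λ) * (C * √M) :=
          mul_le_mul_of_nonneg_left (h hc l hl y) (Real.exp_pos _).le
      _ = _ := by ring

/-- The ratio of the displacements of `e` and `g` is almost invariant along orbits. -/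
lemma exists_abs_log_ratio_le : ∃ C, 0 ≤ C ∧ ∀ {q Q : ℕ} {p P : ℤ} {M : ℝ},
    IsCell F q Q p P M → ∀ l ≤ Q, ∀ x,
      |(Real.log (F^[l] x - liftIter F Q P (F^[l] x)) -
          Real.log (liftIter F q p (F^[l] x) - F^[l] x)) -
        (Real.log (x - liftIter F Q P x) - Real.log (liftIter F q p x - x))| ≤ C * √M := by
  obtain ⟨C, hC, h⟩ := hF.exists_abs_log_deriv_sub_le
  refine ⟨2 * C, by positivity, ?_⟩
  intro q Q p P M hc l hl x
  have hmvt : ∀ a b, a < b → ∃ ξ ∈ Set.Icc a b,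
      Real.log (F^[l] b - F^[l] a) = Real.log (deriv F^[l] ξ) + Real.log (b - a) := by
    intro a b hab
    obtain ⟨ξ, hξ, hξ'⟩ := exists_deriv_eq_slope F^[l] hab
      (hF.contDiff_iterate l).continuous.continuousOn
      ((hF.contDiff_three_iterate l).differentiable (by norm_num)).differentiableOn
    refine ⟨ξ, Ioo_subset_Icc_self hξ, ?_⟩
    rw [eq_div_iff (sub_pos.2 hab).ne'] at hξ'
    rw [← hξ', Real.log_mul (hF.deriv_iterate_pos l ξ).ne' (sub_pos.2 hab).ne']
  obtain ⟨ξ₁, hξ₁, h1⟩ := hmvt _ _ (hc.lt_self x)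
  obtain ⟨ξ₂, hξ₂, h2⟩ := hmvt _ _ (hc.lt x)
  rw [liftIter_iterate hF.map_add_one, liftIter_iterate hF.map_add_one, h1, h2]
  have hx : x ∈ Icc (liftIter F Q P x) (liftIter F q p (liftIter F Q P x)) :=
    ⟨(hc.lt_self x).le, (hc.self_lt x).le⟩
  have h3 := abs_le.1 (h hc l hl _ ξ₁ ⟨hξ₁.1, hξ₁.2.trans hx.2⟩ x hx)
  have h4 := abs_le.1 (h hc l hl _ ξ₂ hξ₂ x (left_mem_Icc.2 (hc.lt x).le))
  rw [abs_le]
  constructor <;> linarith [h3.1, h3.2, h4.1, h4.2]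

/-- The displacement of `e` is almost constant on the arcs `[x, g x]`: it is so on a finite orbit
of `g`, with `k` points, and its derivative of order `k` is small. -/
lemma exists_abs_displacement_sub_le : ∃ C, 0 ≤ C ∧ ∀ {q Q : ℕ} {p P : ℤ} {M : ℝ},
    IsCell F q Q p P M → ∀ x, ∀ y ∈ Icc x (liftIter F q p x),
      |(y - liftIter F Q P y) - (x - liftIter F Q P x)| ≤
        C * (√M ^ (k - 1) * (liftIter F q p x - x) + √M * (x - liftIter F Q P x)) := by
  obtain ⟨Λ, hΛ, hN, hS⟩ := hF.exists_bound_nonlin_schw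
  obtain ⟨C₁, hC₁, h1⟩ := hF.exists_abs_log_ratio_le
  obtain ⟨C₂, hC₂, h2⟩ := hF.exists_abs_log_deriv_le
  obtain ⟨C₃, hC₃, h3⟩ := hF.exists_jetBound_nonlin_iterate (k - 2)
    (by have := hF.three_le; omega)
  obtain ⟨C₄, hC₄, h4⟩ := exists_jetBound_deriv (k - 2) C₃
  have hk := hF.three_le
  set K := Real.exp (3 * Λ) with hK
  have hK1 : 1 ≤ K := Real.one_le_exp (by linarith)
  have hK0 : 0 < K := Real.exp_pos _
  set C₅ := (k * (C₁ + C₂)) * Real.exp (k * (C₁ + C₂)) with hC₅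
  have hC₅0 : 0 ≤ C₅ := by positivity
  set A₁ := (k : ℝ) * (k * K ^ k * K ^ k) ^ (k - 1) * C₅ with hA₁
  set A₂ := C₄ * K * (K ^ k) ^ (k - 1) * (k * K ^ k) ^ k with hA₂
  have hA₁0 : 0 ≤ A₁ := by positivity
  have hA₂0 : 0 ≤ A₂ := by positivity
  refine ⟨A₁ + A₂, by positivity, ?_⟩
  intro q Q p P M hc x y hy
  have hM := hc.pos
  have hs1 : √M ≤ 1 := Real.sqrt_le_one.2 hc.le_one
  have hs0 : 0 ≤ √M := Real.sqrt_nonneg M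
  set g := liftIter F q p with hg
  set e := liftIter F Q P with he
  have hb := sub_pos.2 (hc.lt x)
  have hb' := sub_pos.2 (hc.lt_self x)
  -- one step of `g`
  have hstep : ∀ w, |Real.log (g w - e (g w)) - Real.log (w - e w)| ≤ (C₁ + C₂) * √M := by
    intro w
    have e1 := abs_le.1 (h1 hc q hc.le w)
    have hgw : g w = F^[q] w - p := rfl
    have per : ∀ (n : ℕ) (m : ℤ), liftIter F n m (g w) = liftIter F n m (F^[q] w) - p := by
      intro n m
      have := iterate_add_int hF.map_add_one n (-p) (F^[q] w)
      push_cast at this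
      rw [liftIter, liftIter, hgw, sub_eq_add_neg (F^[q] w), this]
      ring
    have e2 : g w - e (g w) = F^[q] w - e (F^[q] w) := by rw [he, per, hgw]; ring
    have e3 : g (F^[q] w) - F^[q] w = g (g w) - g w := by
      rw [show g (g w) = g (F^[q] w) - p from per q p, hgw]; ring
    obtain ⟨ξ, hξ, hξ'⟩ := exists_deriv_eq_slope g (hc.lt w)
      (hF.contDiff_liftIter q p).continuous.continuousOn
      ((hF.contDiff_three_liftIter q p).differentiable (by norm_num)).differentiableOn
    have hbw := sub_pos.2 (hc.lt w)
    rw [eq_div_iff hbw.ne', hg, deriv_liftIter, ← hg] at hξ'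
    have e4 : Real.log (g (g w) - g w) = Real.log (deriv F^[q] ξ) + Real.log (g w - w) := by
      rw [← hξ', Real.log_mul (hF.deriv_iterate_pos q ξ).ne' hbw.ne']
    have e5 := abs_le.1 (h2 hc ξ)
    rw [← e2, e3, e4] at e1
    rw [abs_le]
    constructor <;> linarith [e1.1, e1.2, e5.1, e5.2]
  have hiter : ∀ j : ℕ, |Real.log (g^[j] x - e (g^[j] x)) - Real.log (x - e x)| ≤
      j * ((C₁ + C₂) * √M) := by
    intro j
    induction j with
    | zero => simp
    | succ j ih =>
      rw [Function.iterate_succ_apply']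
      have e1 := abs_le.1 (hstep (g^[j] x))
      have e2 := abs_le.1 ih
      push_cast
      rw [abs_le]
      constructor <;> linarith [e1.1, e1.2, e2.1, e2.2]
  have hnode : ∀ j < k, |(g^[j] x - e (g^[j] x)) - (x - e x)| ≤ C₅ * √M * (x - e x) := by
    intro j hj
    set τ := Real.log (g^[j] x - e (g^[j] x)) - Real.log (x - e x) with hτ
    have hpos := sub_pos.2 (hc.lt_self (g^[j] x))
    have e1 : g^[j] x - e (g^[j] x) = Real.exp τ * (x - e x) := by
      rw [hτ, Real.exp_sub, Real.exp_log hpos, Real.exp_log hb', div_mul_cancel₀ _ hb'.ne']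
    have hjk : (j : ℝ) ≤ k := by exact_mod_cast hj.le
    have e2 : |τ| ≤ k * (C₁ + C₂) * √M := by
      refine (hiter j).trans ?_
      rw [mul_assoc]
      gcongr
    have e3 : |τ| ≤ k * (C₁ + C₂) := e2.trans (mul_le_of_le_one_right (by positivity) hs1)
    have e4 : |Real.exp τ - 1| ≤ C₅ * √M := by
      refine (abs_exp_sub_one_le_mul_exp τ).trans ?_
      calc _ ≤ (k * (C₁ + C₂) * √M) * Real.exp (k * (C₁ + C₂)) := by gcongr
        _ = _ := by rw [hC₅]; ring
    rw [e1, ← sub_one_mul, abs_mul, abs_of_pos hb']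
    exact mul_le_mul_of_nonneg_right e4 hb'.le
  -- geometry of the nodes
  have hmonog : Monotone fun j : ℕ => g^[j] x := monotone_nat_of_le_succ fun j => by
    simp only [Function.iterate_succ_apply']
    exact (hc.lt _).le
  have hup : ∀ j ≤ k, g^[j] x - x ≤ j * (K ^ k * (g x - x)) := by
    intro j
    induction j with
    | zero => simp
    | succ j ih =>
      intro hj
      have e1 := ih (by omega)
      have e2 := hc.sub_iterate_le_pow hF hN j x
      have e3 : K ^ j ≤ K ^ k := pow_le_pow_right₀ hK1 (by omega)
      have e4 : K ^ j * (g x - x) ≤ K ^ k * (g x - x) := mul_le_mul_of_nonneg_right e3 hb.le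
      rw [Function.iterate_succ_apply']
      push_cast
      change g (g^[j] x) - g^[j] x ≤ K ^ j * (g x - x) at e2
      linarith
  have hlow : ∀ t ∈ Icc x (g^[k] x), g x - x ≤ K ^ k * (g t - t) :=
    fun t ht => hc.le_pow_mul_sub hF hN k x t ht
  have hgx : g x ≤ g^[k] x := by simpa using hmonog (by omega : 1 ≤ k)
  have hxk : x < g^[k] x := (hc.lt x).trans_le hgx
  have hψ : ContDiff ℝ k (fun t => t - e t) := contDiff_id.sub (hF.contDiff_liftIter Q P)
  have hlen : g^[k] x - x ≤ k * K ^ k * (g x - x) := by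
    have := hup k le_rfl
    linarith
  have hE : ∀ t ∈ Icc x (g^[k] x), |iteratedDeriv k (fun t => t - e t) t| ≤
      C₄ * K * (K ^ k) ^ (k - 1) * (√M / (g x - x)) ^ (k - 1) := by
    intro t ht
    have hbt := sub_pos.2 (hc.lt t)
    have e1 := h4 F^[Q] k t _ (hF.contDiff_iterate Q) (hF.deriv_iterate_pos Q) (by omega) hk
      (div_nonneg hs0 hbt.le) (h3 hc Q le_rfl t) (k - 1) (by omega)
    have e2 : iteratedDeriv k (fun t => t - e t) t = -iteratedDeriv (k - 1) (deriv F^[Q]) t := by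
      have hd : deriv (fun t => t - e t) = fun t => 1 - deriv F^[Q] t := by
        funext w
        have := (hasDerivAt_id w).sub
          (hasDerivAt_of_contDiff (hF.contDiff_three_liftIter Q P) (by norm_num) w)
        rw [deriv_liftIter] at this
        exact this.deriv
      obtain ⟨n, rfl⟩ : ∃ n, k = n + 1 := ⟨k - 1, by omega⟩
      rw [iteratedDeriv_succ', hd, Nat.add_sub_cancel,
        iteratedDeriv_const_sub (by omega : 0 < n), iteratedDeriv_neg]
    rw [e2, abs_neg]
    refine e1.trans ?_
    have e3 : √M / (g t - t) ≤ K ^ k * (√M / (g x - x)) := by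
      rw [← mul_div_assoc, div_le_div_iff₀ hbt hb]
      calc _ ≤ √M * (K ^ k * (g t - t)) := mul_le_mul_of_nonneg_left (hlow t ht) hs0
        _ = _ := by ring
    have e4 : deriv F^[Q] t ≤ K := hc.deriv_iterate_le_exp hF hN t
    have e5 := (hF.deriv_iterate_pos Q t).le
    calc _ ≤ C₄ * K * (K ^ k * (√M / (g x - x))) ^ (k - 1) := by
          gcongr
      _ = _ := by rw [mul_pow]; ring
  have key := abs_sub_le_of_nodes (m := k) (t := fun j => g^[j] x) (c := x - e x)
    (d := (g x - x) / K ^ k) (ε := C₅ * √M * (x - e x)) (by omega) hψ (by positivity) hxk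
    (fun i hi => by
      have := hlow (g^[i] x) ⟨hmonog (Nat.zero_le i), hmonog (by omega)⟩
      rw [Function.iterate_succ_apply']
      have h5 : (g x - x) / K ^ k ≤ g (g^[i] x) - g^[i] x := by
        rw [div_le_iff₀ (by positivity)]; linarith
      linarith)
    (fun i hi => ⟨hmonog (Nat.zero_le i), hmonog hi.le⟩) hnode hE ⟨hy.1, hy.2.trans hgx⟩
  refine key.trans ?_
  have hlen0 := (sub_pos.2 hxk).le
  have f1 : (g^[k] x - x) / ((g x - x) / K ^ k) ≤ k * K ^ k * K ^ k := by
    rw [div_div_eq_mul_div, div_le_iff₀ hb]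
    calc _ ≤ (k * K ^ k * (g x - x)) * K ^ k := mul_le_mul_of_nonneg_right hlen (by positivity)
      _ = _ := by ring
  have f2 : (k : ℝ) * ((g^[k] x - x) / ((g x - x) / K ^ k)) ^ (k - 1) * (C₅ * √M * (x - e x)) ≤
      A₁ * (√M * (x - e x)) := by
    calc _ ≤ (k : ℝ) * (k * K ^ k * K ^ k) ^ (k - 1) * (C₅ * √M * (x - e x)) := by gcongr
      _ = _ := by rw [hA₁]; ring
  have f3 : C₄ * K * (K ^ k) ^ (k - 1) * (√M / (g x - x)) ^ (k - 1) * (g^[k] x - x) ^ k ≤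
      A₂ * (√M ^ (k - 1) * (g x - x)) := by
    calc _ ≤ C₄ * K * (K ^ k) ^ (k - 1) * (√M / (g x - x)) ^ (k - 1) *
          (k * K ^ k * (g x - x)) ^ k := by gcongr
      _ = C₄ * K * (K ^ k) ^ (k - 1) * (k * K ^ k) ^ k * √M ^ (k - 1) *
          ((g x - x) ^ k / (g x - x) ^ (k - 1)) := by rw [mul_pow _ (g x - x), div_pow]; ring
      _ = _ := by
          rw [hA₂]
          have : (g x - x) ^ k / (g x - x) ^ (k - 1) = g x - x := by
            rw [div_eq_iff (by positivity), ← pow_succ']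
            congr 1
            omega
          rw [this]; ring
  have g1 : 0 ≤ √M ^ (k - 1) * (g x - x) := by positivity
  have g2 : 0 ≤ √M * (x - e x) := by positivity
  calc _ ≤ A₁ * (√M * (x - e x)) + A₂ * (√M ^ (k - 1) * (g x - x)) := add_le_add f2 f3
    _ ≤ _ := by nlinarith [mul_nonneg hA₁0 g1, mul_nonneg hA₂0 g2]

/-- If the ratio of the displacements of `e` and `g` is equal to `r` somewhere, then it is almost
equal to `r` everywhere. -/
theorem exists_abs_sub_ratio_mul_le : ∃ C, 0 ≤ C ∧ ∀ {q Q : ℕ} {p P : ℤ} {M : ℝ},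
    IsCell F q Q p P M → ∀ r z, z - liftIter F Q P z = r * (liftIter F q p z - z) →
      ∀ x, |(x - liftIter F Q P x) - r * (liftIter F q p x - x)| ≤
        C * (√M ^ (k - 1) * (liftIter F q p x - x) + √M * (x - liftIter F Q P x)) := by
  obtain ⟨Λ, hΛ, hN, hS⟩ := hF.exists_bound_nonlin_schw
  obtain ⟨C₁, hC₁, h1⟩ := hF.exists_abs_log_ratio_le
  obtain ⟨C₂, hC₂, h2⟩ := hF.exists_abs_log_deriv_le
  obtain ⟨C₃, hC₃, h3⟩ := hF.exists_abs_displacement_sub_le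
  set K := Real.exp (3 * Λ) with hK
  have hK0 : 0 < K := Real.exp_pos _
  set E₁ := 2 * C₁ * Real.exp (2 * C₁) with hE₁
  set E₂ := C₂ * Real.exp C₂ with hE₂
  have hE₁0 : 0 ≤ E₁ := by positivity
  have hE₂0 : 0 ≤ E₂ := by positivity
  set D := E₁ + (1 + E₁) * (E₂ * K) with hD
  have hD0 : 0 ≤ D := by positivity
  refine ⟨C₃ + D * (1 + C₃), by positivity, ?_⟩
  intro q Q p P M hc r z hz x
  have hM := hc.pos
  have hs1 : √M ≤ 1 := Real.sqrt_le_one.2 hc.le_one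
  have hs0 : 0 ≤ √M := Real.sqrt_nonneg M
  set g := liftIter F q p with hg
  set e := liftIter F Q P with he
  have hb := sub_pos.2 (hc.lt x)
  have hb' := sub_pos.2 (hc.lt_self x)
  have hbz := sub_pos.2 (hc.lt z)
  have hbz' := sub_pos.2 (hc.lt_self z)
  obtain ⟨i, hi, m, hm⟩ := hc.cover z x
  set y := F^[i] z - m with hy
  have hby := sub_pos.2 (hc.lt y)
  have hby' := sub_pos.2 (hc.lt_self y)
  have hr : 0 < r := by
    rw [hz] at hbz'
    exact pos_of_mul_pos_left hbz' hbz.le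
  -- the ratio at `y`
  have per : ∀ (n : ℕ) (a : ℤ), liftIter F n a y = liftIter F n a (F^[i] z) - m := by
    intro n a
    have := iterate_add_int hF.map_add_one n (-m) (F^[i] z)
    push_cast at this
    rw [liftIter, liftIter, hy, sub_eq_add_neg (F^[i] z), this]
    ring
  have py : y - e y = F^[i] z - e (F^[i] z) := by rw [he, per, hy]; ring
  have py' : g y - y = g (F^[i] z) - F^[i] z := by rw [hg, per, hy]; ring
  set τ := Real.log r - (Real.log (y - e y) - Real.log (g y - y)) with hτ
  have hτ' : |τ| ≤ 2 * C₁ * √M := by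
    have hq := hc.le
    obtain ⟨l₁, l₂, g₁, g₂, hl⟩ : ∃ l₁ l₂, l₁ ≤ Q ∧ l₂ ≤ Q ∧ i = l₁ + l₂ :=
      ⟨i - min i Q, min i Q, by omega, by omega, by omega⟩
    have a1 := abs_le.1 (h1 hc l₁ g₁ (F^[l₂] z))
    have a2 := abs_le.1 (h1 hc l₂ g₂ z)
    rw [← Function.iterate_add_apply, ← hl] at a1
    have a3 : Real.log r = Real.log (z - e z) - Real.log (g z - z) := by
      rw [hz, Real.log_mul hr.ne' hbz.ne']; ring
    rw [hτ, a3, py, py', abs_le]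
    constructor <;> linarith [a1.1, a1.2, a2.1, a2.2]
  have hry : r * (g y - y) = Real.exp τ * (y - e y) := by
    rw [hτ, Real.exp_sub, Real.exp_sub, Real.exp_log hr, Real.exp_log hby, Real.exp_log hby']
    field_simp
    rfl
  have hexp : |Real.exp τ - 1| ≤ E₁ * √M := by
    refine (abs_exp_sub_one_le_mul_exp τ).trans ?_
    have : |τ| ≤ 2 * C₁ := hτ'.trans (mul_le_of_le_one_right (by positivity) hs1)
    calc _ ≤ (2 * C₁ * √M) * Real.exp (2 * C₁) := by gcongr
      _ = _ := by rw [hE₁]; ring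
  have hexp' : Real.exp τ ≤ 1 + E₁ := by
    have := (abs_le.1 hexp).2
    have := mul_le_of_le_one_right hE₁0 hs1
    linarith
  -- the displacements of `g` at `x` and `y`
  have hxy : |(g y - y) - (g x - x)| ≤ E₂ * √M * (g x - x) := by
    have h5 := (convex_Icc x (g x)).norm_image_sub_le_of_norm_hasDerivWithin_le
      (f := fun t => g t - t) (f' := fun t => deriv F^[q] t - 1) (C := E₂ * √M)
      (fun t _ => (by
        have := (hasDerivAt_of_contDiff (hF.contDiff_three_liftIter q p) (by norm_num) t).sub
          (hasDerivAt_id t)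
        rw [deriv_liftIter] at this
        exact this.hasDerivWithinAt))
      (fun t _ => (by
        have h6 := h2 hc t
        have h7 := abs_exp_sub_one_le_mul_exp (Real.log (deriv F^[q] t))
        rw [Real.exp_log (hF.deriv_iterate_pos q t)] at h7
        refine h7.trans ?_
        have h8 : |Real.log (deriv F^[q] t)| ≤ C₂ := h6.trans (mul_le_of_le_one_right hC₂ hs1)
        calc _ ≤ (C₂ * √M) * Real.exp C₂ := by gcongr
          _ = _ := by rw [hE₂]; ring)) (left_mem_Icc.2 (hc.lt x).le) hm
    refine h5.trans ?_
    have : ‖y - x‖ ≤ g x - x := by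
      rw [Real.norm_eq_abs, abs_of_nonneg (sub_nonneg.2 hm.1)]
      linarith [hm.2]
    gcongr
  have hxK := (hc.sub_comparable hF hN hm).2
  have hmain : |r * (g x - x) - (y - e y)| ≤ D * √M * (y - e y) := by
    have e1 : r * (g x - x) - (y - e y) =
        (Real.exp τ - 1) * (y - e y) - r * ((g y - y) - (g x - x)) := by
      rw [sub_one_mul, ← hry]; ring
    have e2 : |r * ((g y - y) - (g x - x))| ≤ (1 + E₁) * (E₂ * K) * √M * (y - e y) := by
      rw [abs_mul, abs_of_pos hr]
      calc _ ≤ r * (E₂ * √M * (g x - x)) := by gcongr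
        _ ≤ r * (E₂ * √M * (K * (g y - y))) := by gcongr
        _ = E₂ * √M * K * (r * (g y - y)) := by ring
        _ = E₂ * √M * K * (Real.exp τ * (y - e y)) := by rw [hry]
        _ ≤ E₂ * √M * K * ((1 + E₁) * (y - e y)) := by gcongr
        _ = _ := by ring
    have e3 : |(Real.exp τ - 1) * (y - e y)| ≤ E₁ * √M * (y - e y) := by
      rw [abs_mul, abs_of_pos hby']
      gcongr
    rw [e1]
    refine (abs_sub _ _).trans ((add_le_add e3 e2).trans (le_of_eq ?_))
    rw [hD]; ring
  have hdis := h3 hc x y hm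
  set R := √M ^ (k - 1) * (g x - x) + √M * (x - e x) with hR
  have hR0 : 0 ≤ √M ^ (k - 1) * (g x - x) := by positivity
  have hye : y - e y ≤ (x - e x) + C₃ * R := by linarith [(abs_le.1 hdis).2]
  have hsR : √M * (y - e y) ≤ (1 + C₃) * R := by
    have hR0' : 0 ≤ R := by positivity
    calc _ ≤ √M * ((x - e x) + C₃ * R) := by gcongr
      _ = √M * (x - e x) + √M * (C₃ * R) := by ring
      _ ≤ R + 1 * (C₃ * R) := by
          refine add_le_add (by linarith) ?_
          exact mul_le_mul_of_nonneg_right hs1 (by positivity)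
      _ = _ := by ring
  have e4 := _root_.abs_sub_le (x - e x) (y - e y) (r * (g x - x))
  rw [abs_sub_comm (y - e y), abs_sub_comm (x - e x) (y - e y)] at e4
  calc _ ≤ _ := e4
    _ ≤ C₃ * R + D * (√M * (y - e y)) := by rw [← mul_assoc]; exact add_le_add hdis hmain
    _ ≤ C₃ * R + D * ((1 + C₃) * R) := by gcongr
    _ = _ := by ring

end IsSmoothLift

/-! ### Combinatorics of orbits with irrational rotation number -/

/-- `F` is a lift of a circle homeomorphism whose orbits are ordered as those of the translation by
the irrational number `α`. -/
structure IsRotLift (F : ℝ → ℝ) (α : ℝ) : Prop where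
  strictMono : StrictMono F
  continuous : Continuous F
  map_add_one : ∀ x, F (x + 1) = F x + 1
  irrational : Irrational α
  add_lt : ∀ (m : ℕ) (b : ℤ) (x : ℝ), (b : ℝ) < m * α → x + b < F^[m] x
  lt_add : ∀ (m : ℕ) (b : ℤ) (x : ℝ), m * α < b → F^[m] x < x + b

/-- `p / q` and `P / Q` are Farey neighbours which approximate `α` from below and from above, and
`P - Q α < q α - p < 1`. Consecutive convergents are of this form, up to the change of `α` into
`-α` when the first one is larger than `α`. -/
structure IsFareyPair (α : ℝ) (q Q : ℕ) (p P : ℤ) : Prop where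
  le : q ≤ Q
  lt : (p : ℝ) < q * α
  lt_one : q * α - p < 1
  gt : Q * α < (P : ℝ)
  lt_sub : (P : ℝ) - Q * α < q * α - p
  det : (q : ℤ) * P - Q * p = 1

/-- The best approximation property of consecutive convergents: decompose `(m, b)` as
`u (q, p) + v (Q, P)` with integers `u ≠ 0` and `v`, which cannot have the same sign. -/
lemma IsFareyPair.best_approx {α : ℝ} {q Q : ℕ} {p P : ℤ} (h : IsFareyPair α q Q p P) {m : ℕ}
    (hm0 : 0 < m) (hm : m < Q) (b : ℤ) :
    q * α - p ≤ m * α - b ∨ m * α - b ≤ -(q * α - p) := by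
  have hdet := h.det
  obtain ⟨u, hu⟩ : ∃ u : ℤ, u = m * P - b * Q := ⟨_, rfl⟩
  obtain ⟨v, hv⟩ : ∃ v : ℤ, v = q * b - p * m := ⟨_, rfl⟩
  have hmuv : (m : ℤ) = u * q + v * Q := by
    rw [hu, hv]; linear_combination (-(m : ℤ)) * hdet
  have hbuv : b = u * p + v * P := by
    rw [hu, hv]; linear_combination (-b) * hdet
  have hδ : 0 < q * α - p := sub_pos.2 h.lt
  have hδ' : 0 < P - Q * α := sub_pos.2 h.gt
  have heq : m * α - b = u * (q * α - p) - v * (P - Q * α) := by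
    have e1 : (m : ℝ) = u * q + v * Q := by exact_mod_cast hmuv
    have e2 : (b : ℝ) = u * p + v * P := by exact_mod_cast hbuv
    rw [e1, e2]; ring
  have hm0' : (0 : ℤ) < m := by exact_mod_cast hm0
  have hm' : (m : ℤ) < Q := by exact_mod_cast hm
  have hq0 : (0 : ℤ) ≤ q := Int.natCast_nonneg q
  have hQ0 : (0 : ℤ) < Q := hm0'.trans hm'
  rcases lt_trichotomy u 0 with hu0 | hu0 | hu0
  · right
    have hv0 : 0 ≤ v := by
      by_contra! hv0
      nlinarith
    have a1 : (u : ℝ) ≤ -1 := by exact_mod_cast (by omega : u ≤ -1)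
    have a2 : (0 : ℝ) ≤ v := by exact_mod_cast hv0
    rw [heq]
    nlinarith
  · exfalso
    rw [hu0, zero_mul, zero_add] at hmuv
    have h1 : 0 < v := by
      by_contra! hv0
      nlinarith
    nlinarith
  · left
    have hv0 : v ≤ 0 := by
      by_contra! hv0
      nlinarith
    have a1 : (1 : ℝ) ≤ u := by exact_mod_cast hu0
    have a2 : (v : ℝ) ≤ 0 := by exact_mod_cast hv0
    rw [heq]
    nlinarith

namespace IsRotLift

variable {F : ℝ → ℝ} {α : ℝ} (hF : IsRotLift F α)
include hF

lemma iterate_strictMono (i : ℕ) : StrictMono F^[i] := hF.strictMono.iterate i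

lemma liftIter_le_of_le {m m' : ℕ} {c c' : ℤ} (h : m * α - c ≤ m' * α - c') (x : ℝ) :
    liftIter F m c x ≤ liftIter F m' c' x := by
  have hirr : ∀ d : ℕ, ∀ a : ℤ, d * α = a → d = 0 ∧ a = 0 := by
    intro d a hda
    have hd : d = 0 := by
      by_contra hd
      exact (hF.irrational.natCast_mul hd).ne_int a hda
    refine ⟨hd, ?_⟩
    rw [hd, Nat.cast_zero, zero_mul] at hda
    exact_mod_cast hda.symm
  rcases le_total m m' with hmm | hmm
  · obtain ⟨d, rfl⟩ := Nat.exists_eq_add_of_le hmm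
    have h1 : ((c' - c : ℤ) : ℝ) ≤ d * α := by push_cast at h ⊢; linarith
    rw [liftIter, liftIter, Nat.add_comm m d, Function.iterate_add_apply]
    rcases h1.eq_or_lt with h2 | h2
    · obtain ⟨rfl, h3⟩ := hirr d _ h2.symm
      rw [show c' = c by omega]
      rfl
    · have := hF.add_lt d _ (F^[m] x) h2
      push_cast at this
      linarith
  · obtain ⟨d, rfl⟩ := Nat.exists_eq_add_of_le hmm
    have h1 : d * α ≤ ((c - c' : ℤ) : ℝ) := by push_cast at h ⊢; linarith
    rw [liftIter, liftIter, Nat.add_comm m' d, Function.iterate_add_apply]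
    rcases h1.eq_or_lt with h2 | h2
    · obtain ⟨rfl, h3⟩ := hirr d _ h2
      rw [show c' = c by omega]
      rfl
    · have := hF.lt_add d _ (F^[m'] x) h2
      push_cast at this
      linarith

lemma lt_liftIter {m : ℕ} {c : ℤ} (h : (c : ℝ) < m * α) (x : ℝ) : x < liftIter F m c x := by
  have := hF.add_lt m c x h
  rw [liftIter]; linarith

lemma liftIter_lt {m : ℕ} {c : ℤ} (h : m * α < c) (x : ℝ) : liftIter F m c x < x := by
  have := hF.lt_add m c x h
  rw [liftIter]; linarith

lemma liftIter_liftIter (m m' : ℕ) (c c' : ℤ) (x : ℝ) :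
    liftIter F m c (liftIter F m' c' x) = liftIter F (m + m') (c + c') x := by
  have := iterate_add_int hF.map_add_one m (-c') (F^[m'] x)
  push_cast at this
  rw [liftIter, liftIter, liftIter, sub_eq_add_neg (F^[m'] x), this, ← Function.iterate_add_apply]
  push_cast
  ring

lemma liftIter_mono (m : ℕ) (c : ℤ) : Monotone (liftIter F m c) := fun x y hxy => by
  rw [liftIter, liftIter]
  linarith [(hF.iterate_strictMono m).monotone hxy]

variable {q Q : ℕ} {p P : ℤ} (h : IsFareyPair α q Q p P)
include h

/-- The arcs `F^i [x, g x]`, `i < Q`, are disjoint modulo `1`. -/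
lemma sum_sub_le_one (x : ℝ) :
    ∑ i ∈ Finset.range Q, (F^[i] (liftIter F q p x) - F^[i] x) ≤ 1 := by
  set b : ℕ → ℤ := fun i => ⌊F^[i] x - x⌋ with hb
  set a : ℕ → ℝ := fun i => liftIter F i (b i) x with ha
  set c : ℕ → ℝ := fun i => liftIter F (i + q) (b i + p) x with hc
  have hca : ∀ i, F^[i] (liftIter F q p x) - F^[i] x = c i - a i := by
    intro i
    have : c i = liftIter F i (b i) (liftIter F q p x) := (hF.liftIter_liftIter _ _ _ _ _).symm
    rw [this, ha]
    simp only [liftIter]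
    ring
  have hac : ∀ i, a i ≤ c i := fun i => by
    have := (hF.iterate_strictMono i).monotone (hF.lt_liftIter h.lt x).le
    have := hca i
    linarith
  have ha0 : ∀ i, x ≤ a i := fun i => by
    have := Int.floor_le (F^[i] x - x)
    simp only [ha, hb, liftIter]
    linarith
  have ha1 : ∀ i, a i < x + 1 := fun i => by
    have := Int.lt_floor_add_one (F^[i] x - x)
    simp only [ha, hb, liftIter]
    linarith
  have hx1 : liftIter F 0 (-1) x = x + 1 := by simp [liftIter]
  have hc1 : ∀ i ∈ Finset.range Q, c i ≤ x + 1 := by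
    intro i hi
    rw [← hx1]
    refine hF.liftIter_le_of_le ?_ x
    rcases Nat.eq_zero_or_pos i with rfl | hi0
    · have : b 0 = 0 := by simp [hb]
      rw [this]
      have := h.lt_one
      push_cast
      simp only [zero_add, zero_mul, zero_sub, neg_neg]
      linarith
    · rcases h.best_approx hi0 (Finset.mem_range.1 hi) (b i + 1) with h1 | h1
      · exfalso
        have h2 : (0 : ℕ) * α - (-1 : ℤ) ≤ i * α - (b i) := by
          have := h.lt
          push_cast at h1 ⊢
          linarith
        have h3 := hF.liftIter_le_of_le h2 x
        rw [hx1] at h3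
        exact absurd (ha1 i) (not_lt.2 h3)
      · push_cast at h1 ⊢
        linarith
  have hdis : ∀ i < Q, ∀ j < Q, i < j → Disjoint (Set.Ioo (a i) (c i)) (Set.Ioo (a j) (c j)) := by
    intro i hi j hj hij
    have hcast : ((j - i : ℕ) : ℝ) = j - i := by rw [Nat.cast_sub hij.le]
    rw [Set.disjoint_left]
    rintro t ⟨h1, h2⟩ ⟨h3, h4⟩
    rcases h.best_approx (m := j - i) (by omega) (by omega) (b j - b i) with h5 | h5
    · have : c i ≤ a j := hF.liftIter_le_of_le (by push_cast at h5 ⊢; rw [hcast] at h5; linarith) x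
      linarith
    · have : c j ≤ a i := hF.liftIter_le_of_le (by push_cast at h5 ⊢; rw [hcast] at h5; linarith) x
      linarith
  have hpd : Set.PairwiseDisjoint (Finset.range Q : Set ℕ) (fun i => Set.Ioo (a i) (c i)) := by
    intro i hi j hj hij
    have hi' : i < Q := by simpa using hi
    have hj' : j < Q := by simpa using hj
    rcases lt_or_gt_of_ne hij with h1 | h1
    · exact hdis i hi' j hj' h1
    · exact (hdis j hj' i hi' h1).symm
  have hvol := MeasureTheory.measure_biUnion_finset (μ := MeasureTheory.volume) hpd
    (fun i _ => measurableSet_Ioo)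
  have hsub : (⋃ i ∈ Finset.range Q, Set.Ioo (a i) (c i)) ⊆ Set.Icc x (x + 1) := by
    refine Set.iUnion₂_subset fun i hi t ht => ⟨(ha0 i).trans ht.1.le, ht.2.le.trans (hc1 i hi)⟩
  have h1 := MeasureTheory.measure_mono (μ := MeasureTheory.volume) hsub
  rw [hvol] at h1
  simp only [Real.volume_Ioo, Real.volume_Icc] at h1
  rw [← ENNReal.ofReal_sum_of_nonneg (fun i _ => sub_nonneg.2 (hac i))] at h1
  have h2 := (ENNReal.ofReal_le_ofReal_iff (by linarith)).1 h1
  rw [Finset.sum_congr rfl fun i _ => hca i]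
  linarith

/-- Among the points of an orbit segment of length `q + Q`, the one closest to `x` from the left
is moved by `g` or by `e⁻¹` to a point of the segment in `[x, g x]`. -/
lemma exists_iterate_mem (z x : ℝ) :
    ∃ i < q + Q, ∃ b : ℤ, F^[i] z - b ∈ Set.Icc x (liftIter F q p x) := by
  have hQ : 0 < Q := by
    have h1 := h.lt
    have h2 := h.le
    by_contra! h3
    obtain rfl : Q = 0 := by omega
    obtain rfl : q = 0 := by omega
    have := h.det
    simp at this
  set d : ℕ → ℤ := fun i => ⌈F^[i] z - x⌉ with hd
  obtain ⟨i, hi, hmax⟩ := Finset.exists_max_image (Finset.range (q + Q))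
    (fun i => liftIter F i (d i) z) ⟨0, by simp; omega⟩
  have hi' := Finset.mem_range.1 hi
  set w := liftIter F i (d i) z with hw
  have hwx : w ≤ x := by
    have := Int.le_ceil (F^[i] z - x)
    simp only [hw, hd, liftIter]
    linarith
  -- any point of the orbit segment to the right of `w` is to the right of `x`
  have hright : ∀ j < q + Q, ∀ b : ℤ, w < liftIter F j b z → x < liftIter F j b z := by
    intro j hj b hwj
    by_contra! hle
    have h1 : d j ≤ b := Int.ceil_le.2 (by simp only [liftIter] at hle; linarith)
    have h2 : (d j : ℝ) ≤ b := by exact_mod_cast h1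
    have h3 := hmax j (Finset.mem_range.2 hj)
    simp only [liftIter] at h3 hwj hw
    linarith
  by_cases hiQ : i < Q
  · refine ⟨q + i, by omega, p + d i, ?_⟩
    have h1 : liftIter F (q + i) (p + d i) z = liftIter F q p w :=
      (hF.liftIter_liftIter _ _ _ _ _).symm
    change liftIter F (q + i) (p + d i) z ∈ _
    refine ⟨(hright _ (by omega) _ ?_).le, ?_⟩
    · rw [h1]; exact hF.lt_liftIter h.lt w
    · rw [h1]; exact hF.liftIter_mono q p hwx
  · refine ⟨i - Q, by omega, d i - P, ?_⟩
    set v := liftIter F (i - Q) (d i - P) z with hv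
    have h1 : liftIter F Q P v = w := by
      rw [hv, hF.liftIter_liftIter, hw]
      congr 1 <;> omega
    change v ∈ _
    refine ⟨(hright _ (by omega) _ ?_).le, ?_⟩
    · rw [← hv, ← h1]; exact hF.liftIter_lt h.gt v
    · have h2 : v < liftIter F q p (liftIter F Q P v) := by
        rw [hF.liftIter_liftIter]
        refine hF.lt_liftIter ?_ v
        have := h.lt_sub
        push_cast
        linarith
      rw [h1] at h2
      exact h2.le.trans (hF.liftIter_mono q p hwx)

lemma isCell {M : ℝ} (hM : ∀ x, liftIter F q p x - x ≤ M) (hM1 : M ≤ 1) :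
    IsCell F q Q p P M where
  le := h.le
  lt := hF.lt_liftIter h.lt
  sub_le := hM
  le_one := hM1
  lt_self := hF.liftIter_lt h.gt
  self_lt x := by
    rw [hF.liftIter_liftIter]
    refine hF.lt_liftIter ?_ x
    have := h.lt_sub
    push_cast
    linarith
  sum_le := hF.sum_sub_le_one h
  cover := hF.exists_iterate_mem h

omit h in
lemma abs_iterate_sub_le (N : ℕ) (w : ℝ) : |F^[N] w - w - N * α| ≤ 1 := by
  have h1 := hF.lt_add N (⌊N * α⌋ + 1) w (by push_cast; exact Int.lt_floor_add_one _)
  have h2 := hF.add_lt N (⌈N * α⌉ - 1) w (by push_cast; linarith [Int.ceil_lt_add_one (N * α)])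
  have h3 := Int.floor_le (N * α)
  have h4 := Int.le_ceil (N * α)
  push_cast at h1 h2
  rw [abs_le]
  constructor <;> linarith

omit h in
/-- Birkhoff sums of the displacement of `F^q - p`. -/
lemma abs_sum_displacement_sub_le (q : ℕ) (p : ℤ) (N : ℕ) (z : ℝ) :
    |∑ j ∈ Finset.range N, (liftIter F q p (F^[j] z) - F^[j] z) - N * (q * α - p)| ≤ q := by
  have h1 : ∀ w, F^[q] w - w = ∑ i ∈ Finset.range q, (F^[i + 1] w - F^[i] w) := fun w => by
    rw [Finset.sum_range_sub (fun i => F^[i] w)]; rfl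
  have h2 : ∑ j ∈ Finset.range N, (F^[q] (F^[j] z) - F^[j] z) =
      ∑ i ∈ Finset.range q, (F^[N] (F^[i] z) - F^[i] z) := by
    simp only [h1]
    rw [Finset.sum_comm]
    refine Finset.sum_congr rfl fun i _ => ?_
    have h3 := Finset.sum_range_sub (fun j => F^[j] (F^[i] z)) N
    rw [Function.iterate_zero_apply] at h3
    rw [← h3]
    refine Finset.sum_congr rfl fun j _ => ?_
    simp only [← Function.iterate_add_apply]
    rw [show i + 1 + j = j + 1 + i by ring, show i + j = j + i by ring]
  have h4 : ∑ j ∈ Finset.range N, (liftIter F q p (F^[j] z) - F^[j] z) - N * (q * α - p) =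
      ∑ i ∈ Finset.range q, (F^[N] (F^[i] z) - F^[i] z - N * α) := by
    have h5 : ∑ i ∈ Finset.range q, (F^[N] (F^[i] z) - F^[i] z - N * α) =
        ∑ j ∈ Finset.range N, (F^[q] (F^[j] z) - F^[j] z) - q * (N * α) := by
      rw [Finset.sum_sub_distrib, ← h2, Finset.sum_const, Finset.card_range, nsmul_eq_mul]
    rw [h5]
    simp only [liftIter, Finset.sum_sub_distrib, Finset.sum_const, Finset.card_range, nsmul_eq_mul]
    ring
  rw [h4]
  refine (Finset.abs_sum_le_sum_abs _ _).trans ?_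
  refine (Finset.sum_le_sum fun i _ => hF.abs_iterate_sub_le N (F^[i] z)).trans ?_
  simp

omit h hF in
/-- A periodic function with bounded Birkhoff sums vanishes somewhere. -/
lemma exists_eq_zero_of_sum_bounded {u : ℝ → ℝ} (hu : Continuous u) (hp : ∀ x, u (x + 1) = u x)
    {C : ℝ} (hC : ∀ N : ℕ, |∑ j ∈ Finset.range N, u (F^[j] 0)| ≤ C) : ∃ z, u z = 0 := by
  by_contra! hne
  obtain ⟨w, hw⟩ := exists_isMinOn_of_periodic hu.abs (fun x => by rw [hp])
  have hε : 0 < |u w| := abs_pos.2 (hne w)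
  have hsign : ∃ σ : ℝ, |σ| = 1 ∧ ∀ x, |u x| = σ * u x := by
    rcases lt_or_gt_of_ne (hne 0) with h0 | h0
    · refine ⟨-1, by simp, fun x => ?_⟩
      rw [neg_one_mul]
      refine abs_of_neg (not_le.1 fun hx => ?_)
      obtain ⟨y, hy⟩ := mem_range_of_exists_le_of_exists_ge hu ⟨0, h0.le⟩ ⟨x, hx⟩
      exact hne y hy
    · refine ⟨1, by simp, fun x => ?_⟩
      rw [one_mul]
      refine abs_of_pos (not_le.1 fun hx => ?_)
      obtain ⟨y, hy⟩ := mem_range_of_exists_le_of_exists_ge hu ⟨x, hx⟩ ⟨0, h0.le⟩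
      exact hne y hy
  obtain ⟨σ, hσ, hσ'⟩ := hsign
  obtain ⟨N, hN⟩ := exists_nat_gt (C / |u w|)
  rw [div_lt_iff₀ hε] at hN
  have h1 : N * |u w| ≤ ∑ j ∈ Finset.range N, |u (F^[j] 0)| := by
    have := Finset.sum_le_sum (s := Finset.range N) (fun j _ => hw (F^[j] 0))
    simpa using this
  have h2 : ∑ j ∈ Finset.range N, |u (F^[j] 0)| = σ * ∑ j ∈ Finset.range N, u (F^[j] 0) := by
    rw [Finset.mul_sum]
    exact Finset.sum_congr rfl fun j _ => hσ' _
  have h3 := le_abs_self (σ * ∑ j ∈ Finset.range N, u (F^[j] 0))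
  rw [abs_mul, hσ, one_mul] at h3
  linarith [hC N]

/-- The ratio of the displacements of `e` and `g` takes the value that it has for the
translation by `α`. -/
lemma exists_ratio_eq : ∃ z, z - liftIter F Q P z =
    ((P - Q * α) / (q * α - p)) * (liftIter F q p z - z) := by
  have hδ : 0 < q * α - p := sub_pos.2 h.lt
  have hδ' : 0 < P - Q * α := sub_pos.2 h.gt
  have hcont : ∀ (m : ℕ) (c : ℤ), Continuous (liftIter F m c) := fun m c =>
    (hF.continuous.iterate m).sub continuous_const
  obtain ⟨z, hz⟩ := exists_eq_zero_of_sum_bounded (F := F)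
    (u := fun x => (q * α - p) * (x - liftIter F Q P x) - (P - Q * α) * (liftIter F q p x - x))
    (by have := hcont Q P; have := hcont q p; fun_prop)
    (fun x => by rw [liftIter_add_one hF.map_add_one, liftIter_add_one hF.map_add_one]; ring)
    (C := (q * α - p) * Q + (P - Q * α) * q)
    (fun N => by
      have h1 := abs_le.1 (hF.abs_sum_displacement_sub_le q p N 0)
      have h2 := abs_le.1 (hF.abs_sum_displacement_sub_le Q P N 0)
      set S := ∑ j ∈ Finset.range N, (liftIter F q p (F^[j] 0) - F^[j] 0)
      set T := ∑ j ∈ Finset.range N, (liftIter F Q P (F^[j] 0) - F^[j] 0) with hT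
      have h3 : ∑ j ∈ Finset.range N, ((q * α - p) * (F^[j] 0 - liftIter F Q P (F^[j] 0)) -
          (P - Q * α) * (liftIter F q p (F^[j] 0) - F^[j] 0)) =
          -(q * α - p) * T - (P - Q * α) * S := by
        rw [Finset.sum_sub_distrib, ← Finset.mul_sum, ← Finset.mul_sum, hT, neg_mul,
          ← mul_neg, ← Finset.sum_neg_distrib]
        simp only [neg_sub]
        rfl
      rw [h3, abs_le]
      constructor <;> nlinarith [h1.1, h1.2, h2.1, h2.2])
  refine ⟨z, ?_⟩
  rw [div_mul_eq_mul_div, eq_div_iff hδ.ne']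
  linarith

end IsRotLift

/-! ### Convergents of continued fractions -/

lemma irrational_inv_fract {ξ : ℝ} (hξ : Irrational ξ) : Irrational (Int.fract ξ)⁻¹ :=
  (hξ.sub_intCast _).inv

lemma one_lt_inv_fract {ξ : ℝ} (hξ : Irrational ξ) : 1 < (Int.fract ξ)⁻¹ :=
  (one_lt_inv₀ (Int.fract_pos.2 (hξ.ne_int _))).2 (Int.fract_lt_one ξ)

lemma one_le_convergent (n : ℕ) : ∀ {ξ : ℝ}, Irrational ξ → 1 < ξ → 1 ≤ ξ.convergent n := by
  have hfloor : ∀ {ξ : ℝ}, 1 < ξ → (1 : ℚ) ≤ (⌊ξ⌋ : ℚ) := fun hξ => by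
    exact_mod_cast Int.le_floor.2 (by exact_mod_cast hξ.le)
  induction n with
  | zero => exact fun _ hξ => hfloor hξ
  | succ n ih =>
    intro ξ hirr hξ
    have h := inv_nonneg.2 (zero_le_one.trans (ih (irrational_inv_fract hirr)
      (one_lt_inv_fract hirr)))
    rw [Real.convergent_succ]
    linarith [hfloor hξ]

section
variable {ξ : ℝ} (hξ : Irrational ξ)
include hξ

lemma convNum_inv_fract_pos (n : ℕ) : 0 < convNum (Int.fract ξ)⁻¹ n :=
  Rat.num_pos.2 (zero_lt_one.trans_le
    (one_le_convergent n (irrational_inv_fract hξ) (one_lt_inv_fract hξ)))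

lemma convNum_succ_and_convDen_succ (n : ℕ) :
    convNum ξ (n + 1) = ⌊ξ⌋ * convNum (Int.fract ξ)⁻¹ n + convDen (Int.fract ξ)⁻¹ n ∧
      (convDen ξ (n + 1) : ℤ) = convNum (Int.fract ξ)⁻¹ n := by
  have hpos := convNum_inv_fract_pos hξ n
  rw [convNum, convDen, convNum, convDen] at *
  rw [Real.convergent_succ]
  set c := ((Int.fract ξ)⁻¹).convergent n with hc
  have h1 : (⌊ξ⌋ : ℚ) + c⁻¹ = ((⌊ξ⌋ * c.num + c.den : ℤ) : ℚ) / (c.num : ℚ) := by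
    have hn : (c.num : ℚ) ≠ 0 := by exact_mod_cast hpos.ne'
    have hcq : c⁻¹ = (c.den : ℚ) / c.num := by
      conv_lhs => rw [← Rat.num_div_den c]
      rw [inv_div]
    rw [hcq]
    push_cast
    field_simp
  have hcop : Nat.Coprime (⌊ξ⌋ * c.num + c.den : ℤ).natAbs c.num.natAbs := by
    have h2 : IsCoprime (c.den : ℤ) c.num := by
      have := c.reduced
      exact (Int.isCoprime_iff_nat_coprime.2 (by simpa using this)).symm
    have h3 : IsCoprime (⌊ξ⌋ * c.num + c.den : ℤ) c.num := by
      rw [add_comm]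
      exact h2.add_mul_right_left _
    exact Int.isCoprime_iff_nat_coprime.1 h3
  rw [h1]
  exact ⟨Rat.num_div_eq_of_coprime hpos hcop, Rat.den_div_eq_of_coprime hpos hcop⟩

end

/-- The number `(-1)^n (q_n ξ - p_n)`, positive when `ξ` is irrational. -/
noncomputable def convSignedDist (ξ : ℝ) (n : ℕ) : ℝ :=
  (-1) ^ n * (convDen ξ n * ξ - convNum ξ n)

lemma convDen_zero (ξ : ℝ) : convDen ξ 0 = 1 := by
  rw [convDen, Real.convergent_zero]; exact Rat.den_intCast _

lemma convNum_zero (ξ : ℝ) : convNum ξ 0 = ⌊ξ⌋ := by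
  rw [convNum, Real.convergent_zero]; exact Rat.num_intCast _

lemma convSignedDist_zero (ξ : ℝ) : convSignedDist ξ 0 = Int.fract ξ := by
  rw [convSignedDist, convDen_zero, convNum_zero, Int.fract]; simp

lemma convSignedDist_succ {ξ : ℝ} (hξ : Irrational ξ) (n : ℕ) :
    convSignedDist ξ (n + 1) = convSignedDist (Int.fract ξ)⁻¹ n * Int.fract ξ := by
  obtain ⟨h1, h2⟩ := convNum_succ_and_convDen_succ hξ n
  have h2' : (convDen ξ (n + 1) : ℝ) = convNum (Int.fract ξ)⁻¹ n := by exact_mod_cast h2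
  have h0 : Int.fract ξ ≠ 0 := (Int.fract_pos.2 (hξ.ne_int _)).ne'
  have h3 : ξ = ⌊ξ⌋ + Int.fract ξ := (Int.floor_add_fract ξ).symm
  rw [convSignedDist, convSignedDist, h1, h2']
  set a := ⌊ξ⌋
  set t := Int.fract ξ
  rw [h3]
  push_cast
  field_simp
  ring

lemma convSignedDist_pos (n : ℕ) : ∀ {ξ : ℝ}, Irrational ξ → 0 < convSignedDist ξ n := by
  induction n with
  | zero =>
    intro ξ hξ
    rw [convSignedDist_zero]
    exact Int.fract_pos.2 (hξ.ne_int _)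
  | succ n ih =>
    intro ξ hξ
    rw [convSignedDist_succ hξ]
    exact mul_pos (ih (irrational_inv_fract hξ)) (Int.fract_pos.2 (hξ.ne_int _))

lemma convSignedDist_succ_lt (n : ℕ) : ∀ {ξ : ℝ}, Irrational ξ →
    convSignedDist ξ (n + 1) < convSignedDist ξ n := by
  induction n with
  | zero =>
    intro ξ hξ
    rw [convSignedDist_succ hξ, convSignedDist_zero, convSignedDist_zero]
    exact mul_lt_of_lt_one_left (Int.fract_pos.2 (hξ.ne_int _)) (Int.fract_lt_one _)
  | succ n ih =>
    intro ξ hξ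
    rw [convSignedDist_succ hξ (n + 1), convSignedDist_succ hξ n]
    exact mul_lt_mul_of_pos_right (ih (irrational_inv_fract hξ)) (Int.fract_pos.2 (hξ.ne_int _))

lemma convSignedDist_lt_one (n : ℕ) {ξ : ℝ} (hξ : Irrational ξ) : convSignedDist ξ n < 1 := by
  induction n with
  | zero => rw [convSignedDist_zero]; exact Int.fract_lt_one ξ
  | succ n ih => exact (convSignedDist_succ_lt n hξ).trans ih

lemma convDist_eq (n : ℕ) {ξ : ℝ} (hξ : Irrational ξ) : convDist ξ n = convSignedDist ξ n := by
  have h := convSignedDist_pos n hξ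
  rw [convDist, ← abs_of_pos h, convSignedDist, abs_mul, abs_pow, abs_neg, abs_one, one_pow, one_mul]

lemma conv_det (n : ℕ) : ∀ {ξ : ℝ}, Irrational ξ →
    (convDen ξ n : ℤ) * convNum ξ (n + 1) - convDen ξ (n + 1) * convNum ξ n = (-1) ^ n := by
  induction n with
  | zero =>
    intro ξ hξ
    obtain ⟨h1, h2⟩ := convNum_succ_and_convDen_succ hξ 0
    rw [h1, h2, convDen_zero, convDen_zero, convNum_zero, convNum_zero]
    push_cast
    ring
  | succ n ih =>
    intro ξ hξ
    obtain ⟨h1, h2⟩ := convNum_succ_and_convDen_succ hξ n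
    obtain ⟨h3, h4⟩ := convNum_succ_and_convDen_succ hξ (n + 1)
    rw [h3, h4, h1, h2, pow_succ]
    linear_combination (-1 : ℤ) * ih (irrational_inv_fract hξ)

lemma conv_mono (n : ℕ) : ∀ {ξ : ℝ}, Irrational ξ → 0 < ξ →
    convNum ξ n ≤ convNum ξ (n + 1) ∧ convDen ξ n ≤ convDen ξ (n + 1) := by
  induction n with
  | zero =>
    intro ξ hξ h0
    obtain ⟨h1, h2⟩ := convNum_succ_and_convDen_succ hξ 0
    have h3 := convNum_inv_fract_pos hξ 0
    have h4 : 0 ≤ ⌊ξ⌋ := Int.floor_nonneg.2 h0.le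
    rw [convDen_zero] at *
    refine ⟨?_, by omega⟩
    rw [h1, convNum_zero]
    push_cast
    nlinarith
  | succ n ih =>
    intro ξ hξ h0
    obtain ⟨h1, h2⟩ := convNum_succ_and_convDen_succ hξ n
    obtain ⟨h3, h4⟩ := convNum_succ_and_convDen_succ hξ (n + 1)
    have h5 := ih (irrational_inv_fract hξ) (zero_lt_one.trans (one_lt_inv_fract hξ))
    have h6 : 0 ≤ ⌊ξ⌋ := Int.floor_nonneg.2 h0.le
    refine ⟨?_, by omega⟩
    rw [h3, h1]
    have := mul_le_mul_of_nonneg_left h5.1 h6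
    omega

lemma isFareyPair_of_even {α : ℝ} (hα : Irrational α) (h0 : 0 < α) {n : ℕ} (hn : Even n) :
    IsFareyPair α (convDen α n) (convDen α (n + 1)) (convNum α n) (convNum α (n + 1)) := by
  have e1 : convSignedDist α n = convDen α n * α - convNum α n := by
    rw [convSignedDist, hn.neg_one_pow, one_mul]
  have e2 : convSignedDist α (n + 1) = convNum α (n + 1) - convDen α (n + 1) * α := by
    rw [convSignedDist, hn.add_one.neg_one_pow]; ring
  have h1 := convSignedDist_pos n hα
  have h2 := convSignedDist_pos (n + 1) hα
  have h3 := convSignedDist_succ_lt n hα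
  have h4 := convSignedDist_lt_one n hα
  rw [e1] at h1 h3 h4
  rw [e2] at h2 h3
  exact ⟨(conv_mono n hα h0).2, by linarith, h4, by linarith, h3, by
    rw [conv_det n hα, hn.neg_one_pow]⟩

lemma isFareyPair_of_odd {α : ℝ} (hα : Irrational α) (h0 : 0 < α) {n : ℕ} (hn : Odd n) :
    IsFareyPair (-α) (convDen α n) (convDen α (n + 1)) (-convNum α n) (-convNum α (n + 1)) := by
  have e1 : convSignedDist α n = convNum α n - convDen α n * α := by
    rw [convSignedDist, hn.neg_one_pow]; ring
  have e2 : convSignedDist α (n + 1) = convDen α (n + 1) * α - convNum α (n + 1) := by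
    rw [convSignedDist, hn.add_one.neg_one_pow, one_mul]
  have h1 := convSignedDist_pos n hα
  have h2 := convSignedDist_pos (n + 1) hα
  have h3 := convSignedDist_succ_lt n hα
  have h4 := convSignedDist_lt_one n hα
  rw [e1] at h1 h3 h4
  rw [e2] at h2 h3
  refine ⟨(conv_mono n hα h0).2, ?_, ?_, ?_, ?_, ?_⟩
  · push_cast; linarith
  · push_cast; linarith
  · push_cast; linarith
  · push_cast; linarith
  · have := conv_det n hα
    rw [hn.neg_one_pow] at this
    linarith

/-! ### Lifts, reflections and arcs -/

/-- The conjugate of `F` by `x ↦ -x`, which exchanges the two orientations. -/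
def reflect (F : ℝ → ℝ) (x : ℝ) : ℝ := -F (-x)

lemma iterate_reflect (F : ℝ → ℝ) (i : ℕ) (x : ℝ) : (reflect F)^[i] x = -F^[i] (-x) := by
  induction i with
  | zero => simp
  | succ i ih => rw [Function.iterate_succ_apply', ih, reflect, neg_neg,
      Function.iterate_succ_apply']

lemma liftIter_reflect (F : ℝ → ℝ) (q : ℕ) (p : ℤ) (x : ℝ) :
    liftIter (reflect F) q (-p) x = -liftIter F q p (-x) := by
  rw [liftIter, liftIter, iterate_reflect]
  push_cast
  ring

lemma reflect_add_one {F : ℝ → ℝ} (hF : ∀ x, F (x + 1) = F x + 1) (x : ℝ) :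
    reflect F (x + 1) = reflect F x + 1 := by
  have := hF (-(x + 1))
  rw [show -(x + 1) + 1 = -x by ring] at this
  rw [reflect, reflect, this]
  ring

lemma IsSmoothLift.reflect {k : ℕ} {F : ℝ → ℝ} (hF : IsSmoothLift k F) :
    IsSmoothLift k (reflect F) where
  three_le := hF.three_le
  contDiff := (hF.contDiff.comp contDiff_neg).neg
  deriv_pos x := by
    have := ((hasDerivAt_of_contDiff hF.contDiff_three (by norm_num) (-x)).comp x
      (hasDerivAt_neg x)).neg
    have h2 : HasDerivAt (CircleDynamics.reflect F) (deriv F (-x)) x :=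
      this.congr_deriv (by simp)
    rw [h2.deriv]
    exact hF.deriv_pos _
  map_add_one := reflect_add_one hF.map_add_one

lemma IsRotLift.reflect {F : ℝ → ℝ} {α : ℝ} (hF : IsRotLift F α) : IsRotLift (reflect F) (-α) where
  strictMono x y hxy := neg_lt_neg (hF.strictMono (neg_lt_neg hxy))
  continuous := (hF.continuous.comp continuous_neg).neg
  map_add_one := reflect_add_one hF.map_add_one
  irrational := hF.irrational.neg
  add_lt m b x h := by
    have := hF.lt_add m (-b) (-x) (by push_cast; linarith)
    rw [iterate_reflect]
    push_cast at this
    linarith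
  lt_add m b x h := by
    have := hF.add_lt m (-b) (-x) (by push_cast; linarith)
    rw [iterate_reflect]
    push_cast at this
    linarith

lemma arcLength_coe (a b : ℝ) : arcLength (a : UnitAddCircle) b = Int.fract (b - a) := by
  rw [arcLength, ← AddCircle.coe_sub]
  have := AddCircle.coe_equivIco_mk_apply (p := (1 : ℝ)) (b - a)
  simpa using this

lemma iterate_coe {F : ℝ → ℝ} {f : UnitAddCircle → UnitAddCircle}
    (hf : ∀ x : ℝ, f (x : UnitAddCircle) = ((F x : ℝ) : UnitAddCircle)) (i : ℕ) (t : ℝ) :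
    f^[i] (t : UnitAddCircle) = ((F^[i] t : ℝ) : UnitAddCircle) := by
  induction i with
  | zero => rfl
  | succ i ih => rw [Function.iterate_succ_apply', ih, hf, Function.iterate_succ_apply']

lemma beta_coe {F : ℝ → ℝ} {α : ℝ} (hF : IsRotLift F α) {f : UnitAddCircle → UnitAddCircle}
    (hf : ∀ x : ℝ, f (x : UnitAddCircle) = ((F x : ℝ) : UnitAddCircle)) (n : ℕ) (t : ℝ) :
    beta f α n (t : UnitAddCircle) =
      (-1) ^ n * (liftIter F (convDen α n) (convNum α n) t - t) := by
  have h1 := convSignedDist_pos n hF.irrational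
  have h2 := convSignedDist_lt_one n hF.irrational
  rw [beta, iterate_coe hf]
  rcases Nat.even_or_odd n with hn | hn
  · rw [if_pos hn, arcLength_coe, hn.neg_one_pow, one_mul]
    rw [convSignedDist, hn.neg_one_pow, one_mul] at h1 h2
    have h3 := hF.lt_liftIter (m := convDen α n) (c := convNum α n) (by linarith) t
    have h4 := hF.lt_add (convDen α n) (convNum α n + 1) t (by push_cast; linarith)
    push_cast at h4
    rw [liftIter] at h3 ⊢
    exact Int.fract_eq_iff.2 ⟨by linarith, by linarith, convNum α n, by ring⟩
  · rw [if_neg (Nat.not_even_iff_odd.2 hn), arcLength_coe, hn.neg_one_pow]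
    rw [convSignedDist, hn.neg_one_pow] at h1 h2
    have h3 := hF.liftIter_lt (m := convDen α n) (c := convNum α n) (by linarith) t
    have h4 := hF.add_lt (convDen α n) (convNum α n - 1) t (by push_cast; linarith)
    push_cast at h4
    rw [liftIter] at h3 ⊢
    exact Int.fract_eq_iff.2 ⟨by linarith, by linarith, -convNum α n, by push_cast; ring⟩

lemma beta_lt_one (f : UnitAddCircle → UnitAddCircle) (α : ℝ) (n : ℕ) (x : UnitAddCircle) :
    beta f α n x < 1 := by
  have h : ∀ a b : UnitAddCircle, arcLength a b < 1 := by
    intro a b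
    induction a using QuotientAddGroup.induction_on with | H a
    induction b using QuotientAddGroup.induction_on with | H b
    exact (arcLength_coe a b).trans_lt (Int.fract_lt_one _)
  rw [beta]
  split_ifs
  · exact h _ _
  · exact h _ _

lemma beta_nonneg (f : UnitAddCircle → UnitAddCircle) (α : ℝ) (n : ℕ) (x : UnitAddCircle) :
    0 ≤ beta f α n x := by
  rw [beta]
  split_ifs
  · exact (AddCircle.equivIco (1 : ℝ) 0 _).2.1
  · exact (AddCircle.equivIco (1 : ℝ) 0 _).2.1

lemma beta_le_betaMax (f : UnitAddCircle → UnitAddCircle) (α : ℝ) (n : ℕ) (x : UnitAddCircle) :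
    beta f α n x ≤ betaMax f α n :=
  le_ciSup (f := beta f α n) ⟨1, by rintro _ ⟨y, rfl⟩; exact (beta_lt_one f α n y).le⟩ x

lemma betaMax_le_one (f : UnitAddCircle → UnitAddCircle) (α : ℝ) (n : ℕ) : betaMax f α n ≤ 1 :=
  ciSup_le fun x => (beta_lt_one f α n x).le

lemma exists_eq_add_int_of_coe_eq {a b : ℝ} (h : (a : UnitAddCircle) = b) :
    ∃ n : ℤ, a = b + n := by
  rw [← sub_eq_zero, ← AddCircle.coe_sub, AddCircle.coe_eq_zero_iff] at h
  obtain ⟨n, hn⟩ := h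
  exact ⟨n, by rw [zsmul_one] at hn; linarith⟩

/-- Two lifts of a circle map, one of which is strictly increasing, differ by an integer. -/
lemma exists_eq_add_int {F G : CircleDeg1Lift} {f : UnitAddCircle → UnitAddCircle}
    (hF : IsLift F f) (hG : IsLift G f) (hmono : StrictMono F) : ∃ n : ℤ, ∀ x, G x = F x + n := by
  have h1 : ∀ x, ∃ n : ℤ, G x = F x + n := fun x => by
    have h2 : ((G x : ℝ) : UnitAddCircle) = ((F x : ℝ) : UnitAddCircle) := by rw [← hF, ← hG]
    exact exists_eq_add_int_of_coe_eq h2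
  choose n hn using h1
  have hper : ∀ x, n (x + 1) = n x := fun x => by
    have := hn (x + 1)
    rw [G.map_add_one, F.map_add_one, hn x] at this
    have : (n x : ℝ) = n (x + 1) := by linarith
    exact_mod_cast this.symm
  have hle : ∀ x y, x ≤ y → y < x + 1 → n x ≤ n y := fun x y hxy hy => by
    have h2 := G.monotone hxy
    have h3 := hmono hy
    rw [hn, hn] at h2
    rw [F.map_add_one] at h3
    have : (n x : ℝ) < n y + 1 := by linarith
    have : n x < n y + 1 := by exact_mod_cast this
    omega
  have hconst : ∀ x ∈ Set.Ico (0 : ℝ) 1, n x = n 0 := fun x hx => by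
    refine le_antisymm ?_ (hle 0 x hx.1 (by linarith [hx.2]))
    rcases hx.1.eq_or_lt with h | h
    · rw [← h]
    · have := hle x (0 + 1) (by linarith [hx.2]) (by linarith)
      rwa [hper] at this
  refine ⟨n 0, fun x => ?_⟩
  have hp : Function.Periodic n 1 := hper
  obtain ⟨y, hy, hxy⟩ := hp.exists_mem_Ico₀ one_pos x
  rw [hn, hxy, hconst y hy]

/-- A circle diffeomorphism with irrational rotation number `α` has a smooth lift whose orbits are
ordered as those of the translation by `α`. -/
lemma exists_lift {k : ℕ} (hk : 3 ≤ k) {f : UnitAddCircle → UnitAddCircle}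
    (hf : IsCircleDiffeo k f) {α : ℝ} (hirr : Irrational α)
    (hrot : HasRotationNumber f (α : UnitAddCircle)) :
    ∃ F : ℝ → ℝ, IsSmoothLift k F ∧ IsRotLift F α ∧
      ∀ x : ℝ, f (x : UnitAddCircle) = ((F x : ℝ) : UnitAddCircle) := by
  obtain ⟨U, hU, hU', hUf⟩ := hf
  obtain ⟨G, hGf, hG⟩ := hrot
  have hder : ∀ x, 0 < deriv (fun x : ℝ => (U : CircleDeg1Lift) x) x := by
    intro x
    have d1 := hasDerivAt_of_contDiff hU (by omega) x
    have d2 := (hasDerivAt_of_contDiff hU' (by omega) ((U : CircleDeg1Lift) x)).comp x d1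
    have d3 : HasDerivAt (fun x : ℝ => x) _ x := d2.congr_of_eventuallyEq
      (Filter.Eventually.of_forall fun y => (CircleDeg1Lift.units_inv_apply_apply U y).symm)
    have d4 := d3.unique (hasDerivAt_id' x)
    have d5 : 0 ≤ deriv (fun x : ℝ => (U : CircleDeg1Lift) x) x :=
      (U : CircleDeg1Lift).monotone.deriv_nonneg
    refine lt_of_le_of_ne d5 fun h => ?_
    rw [← h, mul_zero] at d4
    exact zero_ne_one d4
  have hmono : StrictMono (U : CircleDeg1Lift) := strictMono_of_deriv_pos hder
  obtain ⟨n, hn⟩ := exists_eq_add_int hUf hGf hmono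
  obtain ⟨m, hm⟩ : ∃ m : ℤ, G.translationNumber = α + m :=
    exists_eq_add_int_of_coe_eq hG
  have hFU : (fun x : ℝ => G x - m) = fun x => (U : CircleDeg1Lift) x + ((n : ℝ) - m) := by
    funext x
    rw [hn]
    ring
  have hiter : ∀ (i : ℕ) (x : ℝ), (fun x : ℝ => G x - m)^[i] x = (G ^ i) x - i * m := by
    intro i x
    induction i with
    | zero => simp
    | succ i ih =>
      rw [Function.iterate_succ_apply', ih, pow_succ', CircleDeg1Lift.mul_apply]
      have := G.map_sub_int ((G ^ i) x) (i * m)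
      push_cast at this ⊢
      rw [this]
      ring
  refine ⟨fun x => G x - m, ⟨hk, ?_, ?_, ?_⟩, ⟨?_, ?_, ?_, hirr, ?_, ?_⟩, ?_⟩
  · rw [hFU]; exact hU.add contDiff_const
  · intro x
    rw [hFU, deriv_add_const]
    exact hder x
  · intro x
    simp only [G.map_add_one]
    ring
  · rw [hFU]
    exact hmono.add_const _
  · rw [hFU]
    exact hU.continuous.add continuous_const
  · intro x
    simp only [G.map_add_one]
    ring
  · intro i b x hb
    have := (G ^ i).lt_map_of_int_lt_translationNumber (n := b + i * m)
      (by rw [CircleDeg1Lift.translationNumber_pow, hm]; push_cast; linarith) x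
    rw [hiter]
    push_cast at this
    linarith
  · intro i b x hb
    have := (G ^ i).map_lt_of_translationNumber_lt_int (n := b + i * m)
      (by rw [CircleDeg1Lift.translationNumber_pow, hm]; push_cast; linarith) x
    rw [hiter]
    push_cast at this
    linarith
  · intro x
    rw [hGf, eq_comm, AddCircle.coe_sub]
    simp

end

end CircleDynamics

namespace CircleDynamics

/-- The estimate at a level where `g` moves points to the right. -/
lemma exists_level_bound {k : ℕ} {F : ℝ → ℝ} {α : ℝ} (hs : IsSmoothLift k F) (hr : IsRotLift F α) :
    ∃ C, 0 ≤ C ∧ ∀ {q Q : ℕ} {p P : ℤ} {M : ℝ}, IsFareyPair α q Q p P →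
      (∀ x, liftIter F q p x - x ≤ M) → M ≤ 1 → ∀ x,
        |(x - liftIter F Q P x) - (P - Q * α) / (q * α - p) * (liftIter F q p x - x)| ≤
          C * (√M ^ (k - 1) * (liftIter F q p x - x) + √M * (x - liftIter F Q P x)) := by
  obtain ⟨C, hC, h⟩ := hs.exists_abs_sub_ratio_mul_le
  refine ⟨C, hC, ?_⟩
  intro q Q p P M hpair hM hM1 x
  obtain ⟨z, hz⟩ := hr.exists_ratio_eq hpair
  exact h (hr.isCell hpair hM hM1) _ z hz x

end CircleDynamics

open CircleDynamics in
theorem mainTheorem1 (k : ℕ) (hk : 3 ≤ k) (f : UnitAddCircle → UnitAddCircle)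
    (hf : IsCircleDiffeo k f) (α : ℝ) (hα : α ∈ Set.Ioo (0 : ℝ) 1) (hirr : Irrational α)
    (hrot : HasRotationNumber f (α : UnitAddCircle)) :
    ∃ C : ℝ, 0 < C ∧ ∀ (n : ℕ) (x : UnitAddCircle),
      |beta f α (n + 1) x - convDist α (n + 1) / convDist α n * beta f α n x| ≤
        C * (betaMax f α n ^ (((k : ℝ) - 1) / 2) * beta f α n x +
          betaMax f α n ^ ((1 : ℝ) / 2) * beta f α (n + 1) x) := by
  obtain ⟨F, hs, hr, hfF⟩ := exists_lift hk hf hirr hrot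
  obtain ⟨C₁, hC₁, h₁⟩ := exists_level_bound hs hr
  obtain ⟨C₂, hC₂, h₂⟩ := exists_level_bound hs.reflect hr.reflect
  refine ⟨C₁ + C₂ + 1, by positivity, fun n x => ?_⟩
  induction x using QuotientAddGroup.induction_on with | H t => ?_
  have hβ0 : ∀ m, 0 ≤ beta f α m (t : UnitAddCircle) := fun m => beta_nonneg f α m _
  have hM0 : 0 ≤ betaMax f α n := (hβ0 n).trans (beta_le_betaMax f α n _)
  have e1 : betaMax f α n ^ ((1 : ℝ) / 2) = √(betaMax f α n) := (Real.sqrt_eq_rpow _).symm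
  have e2 : betaMax f α n ^ (((k : ℝ) - 1) / 2) = √(betaMax f α n) ^ (k - 1) := by
    rw [Real.sqrt_eq_rpow, ← Real.rpow_natCast, ← Real.rpow_mul hM0,
      Nat.cast_sub (by omega : 1 ≤ k)]
    congr 1
    push_cast
    ring
  rw [e1, e2, convDist_eq _ hirr, convDist_eq _ hirr]
  have hM1 := betaMax_le_one f α n
  have key : ∃ C, C ≤ C₁ + C₂ + 1 ∧
      |beta f α (n + 1) (t : UnitAddCircle) - convSignedDist α (n + 1) / convSignedDist α n *
        beta f α n (t : UnitAddCircle)| ≤ C * (√(betaMax f α n) ^ (k - 1) *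
          beta f α n (t : UnitAddCircle) +
            √(betaMax f α n) * beta f α (n + 1) (t : UnitAddCircle)) := by
    rcases Nat.even_or_odd n with hn | hn
    · refine ⟨C₁, by linarith, ?_⟩
      have hM : ∀ x, liftIter F (convDen α n) (convNum α n) x - x ≤ betaMax f α n := fun x => by
        have := beta_le_betaMax f α n (x : UnitAddCircle)
        rwa [beta_coe hr hfF, hn.neg_one_pow, one_mul] at this
      have h := h₁ (isFareyPair_of_even hirr hα.1 hn) hM hM1 t
      rw [beta_coe hr hfF, beta_coe hr hfF, convSignedDist, convSignedDist, hn.neg_one_pow,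
        hn.add_one.neg_one_pow, one_mul, one_mul, neg_one_mul, neg_one_mul, neg_sub, neg_sub]
      exact h
    · refine ⟨C₂, by linarith, ?_⟩
      have hM : ∀ x, liftIter (reflect F) (convDen α n) (-convNum α n) x - x ≤ betaMax f α n :=
        fun x => by
          have := beta_le_betaMax f α n ((-x : ℝ) : UnitAddCircle)
          rw [beta_coe hr hfF, hn.neg_one_pow] at this
          rw [liftIter_reflect]
          linarith
      have h := h₂ (isFareyPair_of_odd hirr hα.1 hn) hM hM1 (-t)
      rw [liftIter_reflect, liftIter_reflect, neg_neg] at h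
      rw [beta_coe hr hfF, beta_coe hr hfF, convSignedDist, convSignedDist, hn.neg_one_pow,
        hn.add_one.neg_one_pow, one_mul, one_mul, neg_one_mul, neg_one_mul, neg_sub, neg_sub]
      convert h using 3 <;> push_cast <;> ring
  obtain ⟨C, hC, hCb⟩ := key
  refine hCb.trans (mul_le_mul_of_nonneg_right hC ?_)
  have := hβ0 n
  have := hβ0 (n + 1)
  positivity
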